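/- Let $n,m\ge 0$ and let $E$ be a smooth (Hausdorff, second countable) manifold of dimension $n+m$. Submanifolds of $E$ are embedded and smooth. For $r\ge 1$ let $J^r(E,n)$ be the space of $r$-jets $[L]^r_p$ of $n$-dimensional submanifolds $L$ of $E$ at points $p\in L$: two submanifolds through $p$ have the same $r$-jet at $p$ if, in a chart $(u^\lambda,u^i)$ ($1\le\lambda\le n<i\le n+m$) in which they are the graphs $u^i=f^i(u^1,\dots,u^n)$ and $u^i=f'^i(u^1,\dots,u^n)$ near $p$, the Taylor expansions of $f$ and $f'$ at $p$ agree up to order $r$. Identify $[L]^1_p$ with $T_pL$, so that $\pi_{1,0}\colon J^1(E,n)\to E$ is the Grassmann bundle of $n$-planes in $TE$, and let $\pi_{2,1}\colon J^2(E,n)\to J^1(E,n)$, $[L]^2_p\mapsto[L]^1_p$. Let $H\subset T=\pi_{1,0}^*TE$ be the tautological subbundle over $J^1(E,n)$ (with fibre $\theta$ at $\theta\in J^1(E,n)$), $V=T/H$, and $\omega\colon T\to V$ the projection. For $\theta_2=[L]^2_p$ over $\theta_1=[L]^1_p$, let $R_{\theta_2}\subset T_{\theta_1}J^1(E,n)$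 be the tangent space at $\theta_1$ of $L^{(1)}=\{[L]^1_q : q\in L\}$; it projects isomorphically onto $\theta_1=T_pL$. Let $\Gamma$ be a smooth torsion-free linear connection on $TE\to E$, with covariant derivative $\nabla$. * The equation of $n$-dimensional totally geodesic submanifolds of $\Gamma$ is the set $\mathcal S_\Gamma\subset J^2(E,n)$ of all $[L]^2_p$ such that the second fundamental form of $L$ at $p$ vanishes, i.e. $\nabla_XY\in T_pL$ for all $X\in T_pL$ and all smooth vector fields $Y$ near $p$ tangent to $L$ along $L$. Two such connections $\Gamma,\Gamma'$ are $n$-Grassmannian equivalent if $\mathcal S_\Gamma=\mathcal S_{\Gamma'}$. * The connection $\dot\Gamma$ on $\pi_{1,0}$ induced by $\Gamma$ has the vertical projection $\upsilon_{\dot\Gamma}\colon TJ^1(E,n)\to H^*\otimes V$ given by $\upsilon_{\dot\Gamma}(v)(Y(\theta))=\omega\big(\nabla[\pi_{1,0}^*\Gamma]_vY\big)$ for $v\in T_\theta J^1(E,n)$ and every section $Y$ of $H\subset T$ that is smooth at $\theta$. A $\dot\Gamma$-horizontal lift of $w\in T_pE$ to $\theta\in\pi_{1,0}^{-1}(p)$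 is a vector $v\in T_\theta J^1(E,n)$ that projects to $w$ and satisfies $\upsilon_{\dot\Gamma}(v)=0$. * The $n$-Grassmannian structure of $\Gamma$ is the section $\ddot\Gamma\colon J^1(E,n)\to J^2(E,n)$ of $\pi_{2,1}$ such that, for every $\theta\in J^1(E,n)$ and $w\in\theta$, the vector of $R_{\ddot\Gamma(\theta)}$ that projects to $w$ is the $\dot\Gamma$-horizontal lift of $w$ to $\theta$. **Theorem.** Let $\Gamma$ and $\Gamma'$ be two smooth torsion-free linear connections on $TE\to E$. Then the sections $\ddot\Gamma$ and $\ddot\Gamma'$ exist and are unique, and $\Gamma$ and $\Gamma'$ are $n$-Grassmannian equivalent if and only if $\ddot\Gamma=\ddot\Gamma'$. -/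

import Mathlib

open Set Filter Topology Bundle
open scoped Manifold ContDiff

namespace SubmanifoldJet
noncomputable section

/-- The model space `ℝⁿ × ℝᵐ` of an `(n+m)`-dimensional manifold. A chart with values in it is a
divided chart `(u^λ, u^i)`, with `λ = 1, …, n` and `i = n+1, …, n+m`. -/
abbrev Model (n m : ℕ) : Type := EuclideanSpace ℝ (Fin n) × EuclideanSpace ℝ (Fin m)

/-- The tangent space `T_p S` of a submanifold `S` at `p`: the span of the velocities at time `0`
of the smooth curves through `p` that stay in `S`. -/
def tangentPlane (F : Type*) {M : Type*} [NormedAddCommGroup F] [NormedSpace ℝ F] [TopologicalSpace M]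
    [ChartedSpace F M] (S : Set M) (p : M) : Submodule ℝ (TangentSpace 𝓘(ℝ, F) p) :=
  Submodule.span ℝ {v | ∃ γ : ℝ → M, ContMDiffAt 𝓘(ℝ, ℝ) 𝓘(ℝ, F) ∞ γ 0 ∧ γ 0 = p ∧
    (∀ᶠ t in 𝓝 (0 : ℝ), γ t ∈ S) ∧ mfderiv 𝓘(ℝ, ℝ) 𝓘(ℝ, F) γ 0 (1 : ℝ) = v}

section Submanifolds

variable {n m : ℕ} {E : Type*} [TopologicalSpace E] [ChartedSpace (Model n m) E]

/-- Near `p`, the set `L` is described in the divided chart `φ` (which is concordant to `L` at `p`)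
by `u^i = f^i(u^1, …, u^n)` with `f` smooth. -/
structure IsLocalGraph (L : Set E) (p : E) (φ : OpenPartialHomeomorph E (Model n m))
    (f : EuclideanSpace ℝ (Fin n) → EuclideanSpace ℝ (Fin m)) : Prop where
  mem_maximalAtlas : φ ∈ IsManifold.maximalAtlas 𝓘(ℝ, Model n m) ∞ E
  mem_source : p ∈ φ.source
  contDiffAt : ∀ᶠ x in 𝓝 (φ p).1, ContDiffAt ℝ ∞ f x
  mem_iff : ∀ᶠ q in 𝓝 p, (q ∈ L ↔ (φ q).2 = f (φ q).1)

variable (n m E) in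
/-- An `n`-dimensional embedded submanifold `L` of `E`, with a point of `L`. -/
structure PointedSubmanifold where
  carrier : Set E
  exists_graph : ∀ p ∈ carrier, ∃ (φ : OpenPartialHomeomorph E (Model n m))
    (f : EuclideanSpace ℝ (Fin n) → EuclideanSpace ℝ (Fin m)), IsLocalGraph carrier p φ f
  pt : E
  pt_mem : pt ∈ carrier

/-- `L` and `L'` have a contact of order `r` at their common base point: in a divided chart
concordant to both of them the Taylor expansions of `f` and `f'` agree up to order `r`. -/
def HasContact (r : ℕ) (P Q : PointedSubmanifold n m E) : Prop :=
  P.pt = Q.pt ∧ ∃ (φ : OpenPartialHomeomorph E (Model n m))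
    (f g : EuclideanSpace ℝ (Fin n) → EuclideanSpace ℝ (Fin m)),
    IsLocalGraph P.carrier P.pt φ f ∧ IsLocalGraph Q.carrier Q.pt φ g ∧
    ∀ k ≤ r, iteratedFDeriv ℝ k f (φ P.pt).1 = iteratedFDeriv ℝ k g (φ P.pt).1

variable (n m E) in
/-- The space `J^r(E,n)` of `r`-jets of `n`-dimensional submanifolds. -/
def Jet (r : ℕ) : Type _ := Quot (HasContact (n := n) (m := m) (E := E) r)

/-- The `r`-jet `[L]^r_p`. -/
def PointedSubmanifold.jet (r : ℕ) (P : PointedSubmanifold n m E) : Jet n m E r := Quot.mk _ P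

variable (n m E) in
/-- The space `J^1(E,n)`, identified with the Grassmann bundle of `n`-dimensional subspaces of the
tangent spaces of `E`. -/
structure GrassmannBundle where
  pt : E
  plane : Submodule ℝ (TangentSpace 𝓘(ℝ, Model n m) pt)
  finrank_plane : Module.finrank ℝ plane = n

end Submanifolds

section TangentGraph

variable {n m : ℕ} {E : Type*} [TopologicalSpace E] [ChartedSpace (Model n m) E]

/-- The differential of a divided chart. -/
abbrev dChart (φ : OpenPartialHomeomorph E (Model n m)) (p : E) :
    TangentSpace 𝓘(ℝ, Model n m) p →L[ℝ] Model n m :=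
  mfderiv 𝓘(ℝ, Model n m) 𝓘(ℝ, Model n m) φ p

/-- The differential of the inverse of a divided chart. -/
abbrev dChartSymm (φ : OpenPartialHomeomorph E (Model n m)) (z : Model n m) :
    Model n m →L[ℝ] TangentSpace 𝓘(ℝ, Model n m) (φ.symm z) :=
  mfderiv 𝓘(ℝ, Model n m) 𝓘(ℝ, Model n m) φ.symm z

theorem mdiff_of_mem {φ : OpenPartialHomeomorph E (Model n m)}
    (hφ : φ ∈ IsManifold.maximalAtlas 𝓘(ℝ, Model n m) ∞ E) {p : E} (hp : p ∈ φ.source) :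
    MDifferentiableAt 𝓘(ℝ, Model n m) 𝓘(ℝ, Model n m) φ p :=
  (contMDiffAt_of_mem_maximalAtlas hφ hp).mdifferentiableAt (by simp)

theorem mdiff_symm_of_mem {φ : OpenPartialHomeomorph E (Model n m)}
    (hφ : φ ∈ IsManifold.maximalAtlas 𝓘(ℝ, Model n m) ∞ E) {z : Model n m} (hz : z ∈ φ.target) :
    MDifferentiableAt 𝓘(ℝ, Model n m) 𝓘(ℝ, Model n m) φ.symm z :=
  (contMDiffAt_symm_of_mem_maximalAtlas hφ hz).mdifferentiableAt (by simp)

theorem dChart_dChartSymm {φ : OpenPartialHomeomorph E (Model n m)}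
    (hφ : φ ∈ IsManifold.maximalAtlas 𝓘(ℝ, Model n m) ∞ E) {z : Model n m} (hz : z ∈ φ.target)
    (v : Model n m) : dChart φ (φ.symm z) (dChartSymm φ z v) = v := by
  have h1 := (mdiff_of_mem hφ (φ.map_target hz)).hasMFDerivAt.comp z
    (mdiff_symm_of_mem hφ hz).hasMFDerivAt
  have h2 : HasMFDerivAt 𝓘(ℝ, Model n m) 𝓘(ℝ, Model n m) (φ ∘ φ.symm) z
      (ContinuousLinearMap.id ℝ _) := by
    refine (hasMFDerivAt_id z).congr_of_eventuallyEq ?_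
    filter_upwards [φ.open_target.mem_nhds hz] with y hy using φ.right_inv hy
  exact congrArg (fun T => T v) (hasMFDerivAt_unique h1 h2)

theorem dChartSymm_dChart {φ : OpenPartialHomeomorph E (Model n m)}
    (hφ : φ ∈ IsManifold.maximalAtlas 𝓘(ℝ, Model n m) ∞ E) {p : E} (hp : p ∈ φ.source)
    (v : TangentSpace 𝓘(ℝ, Model n m) p) : dChartSymm φ (φ p) (dChart φ p v) = v := by
  have h1 := (mdiff_symm_of_mem hφ (φ.map_source hp)).hasMFDerivAt.comp p
    (mdiff_of_mem hφ hp).hasMFDerivAt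
  have h2 : HasMFDerivAt 𝓘(ℝ, Model n m) 𝓘(ℝ, Model n m) (φ.symm ∘ φ) p
      (ContinuousLinearMap.id ℝ _) := by
    refine (hasMFDerivAt_id p).congr_of_eventuallyEq ?_
    filter_upwards [φ.open_source.mem_nhds hp] with y hy using φ.left_inv hy
  exact congrArg (fun T => T v) (hasMFDerivAt_unique h1 h2)

theorem dChart_injective {φ : OpenPartialHomeomorph E (Model n m)}
    (hφ : φ ∈ IsManifold.maximalAtlas 𝓘(ℝ, Model n m) ∞ E) {p : E} (hp : p ∈ φ.source) :
    Function.Injective (dChart φ p) := fun v w h => by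
  rw [← dChartSymm_dChart hφ hp v, h, dChartSymm_dChart hφ hp w]

/-- In a divided chart, the tangent space of the graph of `f` is the graph of the differential. -/
theorem map_tangentPlane {L : Set E} {p : E} (hp : p ∈ L)
    {φ : OpenPartialHomeomorph E (Model n m)}
    {f : EuclideanSpace ℝ (Fin n) → EuclideanSpace ℝ (Fin m)} (h : IsLocalGraph L p φ f) :
    (tangentPlane (Model n m) L p).map (dChart φ p).toLinearMap = (fderiv ℝ f (φ p).1).toLinearMap.graph := by
  have hφ := h.mem_maximalAtlas
  have hps := h.mem_source
  have hf : DifferentiableAt ℝ f (φ p).1 := h.contDiffAt.self_of_nhds.differentiableAt (by simp)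
  have hpt : (φ p).2 = f (φ p).1 := h.mem_iff.self_of_nhds.1 hp
  apply le_antisymm
  · rw [tangentPlane, Submodule.map_span_le]
    rintro _ ⟨γ, hγ, rfl, hL, rfl⟩
    have h1 : HasFDerivAt (φ ∘ γ) ((dChart φ (γ 0)).comp (mfderiv 𝓘(ℝ, ℝ) 𝓘(ℝ, Model n m) γ 0))
        (0 : ℝ) := hasMFDerivAt_iff_hasFDerivAt.1 ((mdiff_of_mem hφ hps).hasMFDerivAt.comp (0 : ℝ)
      (hγ.mdifferentiableAt (by simp)).hasMFDerivAt)
    have h2 := h1.fst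
    have h3 := h1.snd
    have h4 := hf.hasFDerivAt.comp (0 : ℝ) h2
    have h5 : HasFDerivAt (fun t => (φ (γ t)).2) _ (0 : ℝ) := h4.congr_of_eventuallyEq (by
      filter_upwards [hL, hγ.continuousAt.eventually h.mem_iff] with t ht ht2 using ht2.1 ht)
    exact congrArg (fun T => T 1) (h3.unique h5)
  · rintro ⟨a, b⟩ hab
    obtain rfl : b = fderiv ℝ f (φ p).1 a := hab
    refine ⟨dChartSymm φ (φ p) (a, fderiv ℝ f (φ p).1 a), ?_, ?_⟩
    · let c : ℝ → Model n m := fun t => ((φ p).1 + t • a, f ((φ p).1 + t • a))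
      have hc0 : c 0 = φ p := by simp [c, ← hpt]
      have hl : ContDiff ℝ ∞ (fun t : ℝ => (φ p).1 + t • a) := by fun_prop
      have hcs : ContDiffAt ℝ ∞ c 0 := by
        refine hl.contDiffAt.prodMk (ContDiffAt.comp (0 : ℝ) ?_ hl.contDiffAt)
        simpa using h.contDiffAt.self_of_nhds
      have hcd : HasFDerivAt c (ContinuousLinearMap.toSpanSingleton ℝ
          ((a, fderiv ℝ f (φ p).1 a) : Model n m)) (0 : ℝ) := by
        have e1 : HasDerivAt (fun t : ℝ => (φ p).1 + t • a) a 0 := by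
          simpa using ((hasDerivAt_id (0 : ℝ)).smul_const a).const_add (φ p).1
        have e2 : HasDerivAt (fun t : ℝ => f ((φ p).1 + t • a)) (fderiv ℝ f (φ p).1 a) 0 := by
          refine HasFDerivAt.comp_hasDerivAt (0 : ℝ) ?_ e1
          simpa using hf.hasFDerivAt
        exact (e1.prodMk e2).hasFDerivAt
      have hsm : ContMDiffAt 𝓘(ℝ, Model n m) 𝓘(ℝ, Model n m) ∞ φ.symm (c 0) :=
        hc0 ▸ contMDiffAt_symm_of_mem_maximalAtlas hφ (φ.map_source hps)
      have hγ : ContMDiffAt 𝓘(ℝ, ℝ) 𝓘(ℝ, Model n m) ∞ (φ.symm ∘ c) 0 :=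
        hsm.comp (0 : ℝ) hcs.contMDiffAt
      have hγ0 : (φ.symm ∘ c) 0 = p := by simp [hc0, φ.left_inv hps]
      have hd := (mdiff_symm_of_mem hφ (hc0.symm ▸ φ.map_source hps)).hasMFDerivAt.comp (0 : ℝ)
        hcd.hasMFDerivAt
      refine Submodule.subset_span ⟨φ.symm ∘ c, hγ, hγ0, ?_, ?_⟩
      · have hcon : Tendsto (φ.symm ∘ c) (𝓝 0) (𝓝 p) := by
          simpa [hc0, φ.left_inv hps] using hγ.continuousAt.tendsto
        have htar : ∀ᶠ t in 𝓝 (0 : ℝ), c t ∈ φ.target :=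
          hcs.continuousAt.eventually (hc0.symm ▸ φ.open_target.mem_nhds (φ.map_source hps))
        filter_upwards [hcon.eventually h.mem_iff, htar] with t ht ht2
        refine ht.2 ?_
        simp [φ.right_inv ht2, c]
      · rw [hd.mfderiv]
        change dChartSymm φ (c 0) ((1 : ℝ) • (a, fderiv ℝ f (φ p).1 a)) = _
        rw [hc0, one_smul]
    · have := dChart_dChartSymm hφ (φ.map_source hps) (a, fderiv ℝ f (φ p).1 a)
      rw [φ.left_inv hps] at this
      exact this

theorem finrank_tangentPlane (P : PointedSubmanifold n m E) :
    Module.finrank ℝ (tangentPlane (Model n m) P.carrier P.pt) = n := by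
  obtain ⟨φ, f, h⟩ := P.exists_graph P.pt P.pt_mem
  have h1 := LinearEquiv.finrank_eq (Submodule.equivMapOfInjective
    (dChart φ P.pt).toLinearMap (dChart_injective h.mem_maximalAtlas h.mem_source)
    (tangentPlane (Model n m) P.carrier P.pt))
  rw [h1, map_tangentPlane P.pt_mem h]
  rw [LinearMap.graph_eq_range_prod, LinearMap.finrank_range_of_inj, finrank_euclideanSpace_fin]
  intro x y hxy
  exact congrArg Prod.fst hxy

/-- The `1`-jet `[L]^1_p`, identified with the tangent space `T_p L`. -/
def PointedSubmanifold.jet1 (P : PointedSubmanifold n m E) : GrassmannBundle n m E :=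
  ⟨P.pt, tangentPlane (Model n m) P.carrier P.pt, finrank_tangentPlane P⟩

theorem HasContact.jet1_eq {r : ℕ} (hr : 1 ≤ r) {P Q : PointedSubmanifold n m E}
    (h : HasContact r P Q) : P.jet1 = Q.jet1 := by
  obtain ⟨L, hL, p, hp⟩ := P
  obtain ⟨L', hL', p', hp'⟩ := Q
  obtain ⟨rfl : p = p', φ, f, g, hf, hg, hfg⟩ := h
  have h1 : fderiv ℝ f (φ p).1 = fderiv ℝ g (φ p).1 := by
    ext1 v
    have := congrArg (fun T => T (fun _ => v)) (hfg 1 hr)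
    simpa [iteratedFDeriv_one_apply] using this
  have h2 : tangentPlane (Model n m) L p = tangentPlane (Model n m) L' p := by
    apply Submodule.map_injective_of_injective (dChart_injective hf.mem_maximalAtlas hf.mem_source)
    rw [map_tangentPlane hp hf, map_tangentPlane hp' hg, h1]
  simp only [PointedSubmanifold.jet1, h2]

/-- The projection `π_{2,1} : J^2(E,n) → J^1(E,n)`, `[L]^2_p ↦ [L]^1_p`. -/
def jetProj : Jet n m E 2 → GrassmannBundle n m E :=
  Quot.lift PointedSubmanifold.jet1 fun _ _ h => h.jet1_eq one_le_two


end TangentGraph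

section GraphTransform

variable {X Y : Type*} [NormedAddCommGroup X] [NormedSpace ℝ X] [NormedAddCommGroup Y]
  [NormedSpace ℝ Y]

/-- The map `x ↦ (x, A x)`. -/
def graphEmb (A : X →L[ℝ] Y) : X →L[ℝ] X × Y :=
  ContinuousLinearMap.inl ℝ X Y + (ContinuousLinearMap.inr ℝ X Y).comp A

/-- The map `x ↦ pr₁ (T (x, A x))`. -/
def graphFst (T : X × Y →L[ℝ] X × Y) (A : X →L[ℝ] Y) : X →L[ℝ] X :=
  (ContinuousLinearMap.fst ℝ X Y).comp (T.comp (graphEmb A))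

/-- The map `x ↦ pr₂ (T (x, A x))`. -/
def graphSnd (T : X × Y →L[ℝ] X × Y) (A : X →L[ℝ] Y) : X →L[ℝ] Y :=
  (ContinuousLinearMap.snd ℝ X Y).comp (T.comp (graphEmb A))

theorem graphEmb_apply (A : X →L[ℝ] Y) (x : X) : graphEmb A x = (x, A x) := by
  simp [graphEmb]

theorem map_graph_eq_iff (T : X × Y →L[ℝ] X × Y) (A B : X →L[ℝ] Y) :
    A.toLinearMap.graph.map T.toLinearMap = B.toLinearMap.graph ↔
      (∀ x, graphSnd T A x = B (graphFst T A x)) ∧ Function.Surjective (graphFst T A) := by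
  constructor
  · intro h
    constructor
    · intro x
      have : T (x, A x) ∈ B.toLinearMap.graph := h ▸ Submodule.mem_map_of_mem (by simp)
      simpa [graphSnd, graphFst, graphEmb_apply] using this
    · intro x
      have : (x, B x) ∈ A.toLinearMap.graph.map T.toLinearMap := h ▸ by simp
      obtain ⟨⟨a, b⟩, hab, e⟩ := this
      obtain rfl : b = A a := by simpa using hab
      exact ⟨a, by simpa [graphFst, graphEmb_apply] using congrArg Prod.fst e⟩
  · rintro ⟨h1, h2⟩
    ext ⟨c, d⟩
    constructor
    · rintro ⟨⟨a, b⟩, hab, e⟩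
      obtain rfl : b = A a := by simpa using hab
      have := h1 a
      simp only [graphSnd, graphFst, graphEmb_apply, ContinuousLinearMap.comp_apply] at this
      change T (a, A a) = (c, d) at e
      rw [e] at this
      simpa using this
    · intro hcd
      obtain rfl : d = B c := by simpa using hcd
      obtain ⟨a, rfl⟩ := h2 c
      refine ⟨(a, A a), by simp, Prod.ext ?_ ?_⟩
      · simp [graphFst, graphEmb_apply]
      · rw [← h1]; simp [graphSnd, graphEmb_apply]

theorem exists_map_graph_iff [FiniteDimensional ℝ X] (T : X × Y →L[ℝ] X × Y)
    (A : X →L[ℝ] Y) :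
    (∃ B : X →L[ℝ] Y, A.toLinearMap.graph.map T.toLinearMap = B.toLinearMap.graph) ↔
      IsUnit (graphFst T A) := by
  have := FiniteDimensional.complete ℝ X
  have hsurj : Function.Surjective (graphFst T A) → IsUnit (graphFst T A) := fun h =>
    ContinuousLinearMap.isUnit_iff_bijective.2
      ⟨(LinearMap.injective_iff_surjective (f := (graphFst T A).toLinearMap)).2 h, h⟩
  constructor
  · rintro ⟨B, hB⟩
    exact hsurj ((map_graph_eq_iff T A B).1 hB).2
  · intro h
    refine ⟨(graphSnd T A).comp (Ring.inverse (graphFst T A)), (map_graph_eq_iff T A _).2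
      ⟨fun x => ?_, (ContinuousLinearMap.isUnit_iff_bijective.1 h).2⟩⟩
    have := congrArg (fun S => S x) (Ring.inverse_mul_cancel _ h)
    simp only [mul_apply_eq_comp, one_apply_eq_self] at this
    rw [ContinuousLinearMap.comp_apply, this]

theorem eq_of_map_graph {T : X × Y →L[ℝ] X × Y} {A B : X →L[ℝ] Y} (hu : IsUnit (graphFst T A))
    (h : A.toLinearMap.graph.map T.toLinearMap = B.toLinearMap.graph) :
    B = (graphSnd T A).comp (Ring.inverse (graphFst T A)) := by
  ext1 x
  have := congrArg (fun S => S x) (Ring.mul_inverse_cancel _ hu)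
  simp only [mul_apply_eq_comp, one_apply_eq_self] at this
  rw [ContinuousLinearMap.comp_apply, ((map_graph_eq_iff T A B).1 h).1, this]

theorem graph_injective {A B : X →L[ℝ] Y} (h : A.toLinearMap.graph = B.toLinearMap.graph) :
    A = B := by
  ext1 x
  have : (x, A x) ∈ B.toLinearMap.graph := h ▸ by simp
  simpa using this

theorem finrank_graph (A : X →L[ℝ] Y) :
    Module.finrank ℝ A.toLinearMap.graph = Module.finrank ℝ X := by
  rw [LinearMap.graph_eq_range_prod, LinearMap.finrank_range_of_inj]
  intro x y hxy
  exact congrArg Prod.fst hxy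

end GraphTransform

section GrassmannCharts

variable {n m : ℕ} {E : Type*} [TopologicalSpace E] [ChartedSpace (Model n m) E]

variable (n m) in
/-- The model space of `J^1(E,n)`, with coordinates `(u^λ, u^i; u^i_λ)`. -/
abbrev GrassmannModel : Type :=
  Model n m × (EuclideanSpace ℝ (Fin n) →L[ℝ] EuclideanSpace ℝ (Fin m))

/-- In the divided chart `φ`, the plane `θ` is the graph of `A = (u^i_λ)`. -/
def HasSlope (φ : OpenPartialHomeomorph E (Model n m)) (θ : GrassmannBundle n m E)
    (A : EuclideanSpace ℝ (Fin n) →L[ℝ] EuclideanSpace ℝ (Fin m)) : Prop :=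
  θ.plane.map (dChart φ θ.pt).toLinearMap = A.toLinearMap.graph

open Classical in
/-- The coordinates `(u^i_λ)` of `θ` in the divided chart `φ`. -/
def slope (φ : OpenPartialHomeomorph E (Model n m)) (θ : GrassmannBundle n m E) :
    EuclideanSpace ℝ (Fin n) →L[ℝ] EuclideanSpace ℝ (Fin m) :=
  if h : ∃ A, HasSlope φ θ A then h.choose else 0

theorem hasSlope_slope {φ : OpenPartialHomeomorph E (Model n m)} {θ : GrassmannBundle n m E}
    (h : ∃ A, HasSlope φ θ A) : HasSlope φ θ (slope φ θ) := by
  rw [slope, dif_pos h]; exact h.choose_spec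

theorem HasSlope.slope_eq {φ : OpenPartialHomeomorph E (Model n m)} {θ : GrassmannBundle n m E}
    {A : EuclideanSpace ℝ (Fin n) →L[ℝ] EuclideanSpace ℝ (Fin m)} (h : HasSlope φ θ A) :
    slope φ θ = A :=
  graph_injective ((hasSlope_slope ⟨A, h⟩).symm.trans h)

theorem finrank_map_dChartSymm {φ : OpenPartialHomeomorph E (Model n m)}
    (hφ : φ ∈ IsManifold.maximalAtlas 𝓘(ℝ, Model n m) ∞ E) {u : Model n m} (hu : u ∈ φ.target)
    (A : EuclideanSpace ℝ (Fin n) →L[ℝ] EuclideanSpace ℝ (Fin m)) :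
    Module.finrank ℝ (A.toLinearMap.graph.map (dChartSymm φ u).toLinearMap) = n := by
  have hinj : Function.Injective (dChartSymm φ u) := fun v w e => by
    rw [← dChart_dChartSymm hφ hu v, e, dChart_dChartSymm hφ hu w]
  rw [← LinearEquiv.finrank_eq (Submodule.equivMapOfInjective
    (dChartSymm φ u).toLinearMap hinj A.toLinearMap.graph), finrank_graph,
    finrank_euclideanSpace_fin]

variable (n m) in
/-- An arbitrary `n`-plane at `p`, used only as a default value. -/
def defaultPlane (p : E) : GrassmannBundle n m E :=
  ⟨p, (0 : EuclideanSpace ℝ (Fin n) →L[ℝ] EuclideanSpace ℝ (Fin m)).toLinearMap.graph,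
    (finrank_graph _).trans finrank_euclideanSpace_fin⟩

open Classical in
/-- The `n`-plane whose coordinates in the divided chart `φ` are `z`. -/
def planeOfSlope (φ : OpenPartialHomeomorph E (Model n m))
    (hφ : φ ∈ IsManifold.maximalAtlas 𝓘(ℝ, Model n m) ∞ E) (z : GrassmannModel n m) :
    GrassmannBundle n m E :=
  if hz : z.1 ∈ φ.target then
    ⟨φ.symm z.1, z.2.toLinearMap.graph.map (dChartSymm φ z.1).toLinearMap,
      finrank_map_dChartSymm hφ hz z.2⟩
  else defaultPlane n m (φ.symm z.1)

theorem planeOfSlope_of_mem {φ : OpenPartialHomeomorph E (Model n m)}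
    (hφ : φ ∈ IsManifold.maximalAtlas 𝓘(ℝ, Model n m) ∞ E) {z : GrassmannModel n m}
    (hz : z.1 ∈ φ.target) : planeOfSlope φ hφ z =
      ⟨φ.symm z.1, z.2.toLinearMap.graph.map (dChartSymm φ z.1).toLinearMap,
        finrank_map_dChartSymm hφ hz z.2⟩ := dif_pos hz

theorem hasSlope_planeOfSlope {φ : OpenPartialHomeomorph E (Model n m)}
    (hφ : φ ∈ IsManifold.maximalAtlas 𝓘(ℝ, Model n m) ∞ E) {z : GrassmannModel n m}
    (hz : z.1 ∈ φ.target) : HasSlope φ (planeOfSlope φ hφ z) z.2 := by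
  rw [planeOfSlope_of_mem hφ hz]
  unfold HasSlope
  rw [← Submodule.map_comp]
  convert! Submodule.map_id _
  exact LinearMap.ext (dChart_dChartSymm hφ hz)

theorem GrassmannBundle.eq_of_hasSlope {φ : OpenPartialHomeomorph E (Model n m)}
    (hφ : φ ∈ IsManifold.maximalAtlas 𝓘(ℝ, Model n m) ∞ E) {θ θ' : GrassmannBundle n m E}
    (hθ : θ.pt ∈ φ.source) (hpt : θ.pt = θ'.pt)
    {A : EuclideanSpace ℝ (Fin n) →L[ℝ] EuclideanSpace ℝ (Fin m)}
    (h : HasSlope φ θ A) (h' : HasSlope φ θ' A) : θ = θ' := by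
  obtain ⟨p, W, hW⟩ := θ
  obtain ⟨p', W', hW'⟩ := θ'
  obtain rfl : p = p' := hpt
  have : W = W' := Submodule.map_injective_of_injective (dChart_injective hφ hθ) (h.trans h'.symm)
  subst this
  rfl

/-- The chart `(u^λ, u^i; u^i_λ)` of `J^1(E,n)` induced by the divided chart `φ`; its domain
consists of the planes to which `φ` is concordant. -/
def grassmannChart (φ : OpenPartialHomeomorph E (Model n m))
    (hφ : φ ∈ IsManifold.maximalAtlas 𝓘(ℝ, Model n m) ∞ E) :
    PartialEquiv (GrassmannBundle n m E) (GrassmannModel n m) where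
  toFun θ := (φ θ.pt, slope φ θ)
  invFun := planeOfSlope φ hφ
  source := {θ | θ.pt ∈ φ.source ∧ ∃ A, HasSlope φ θ A}
  target := {z | z.1 ∈ φ.target}
  map_source' θ hθ := φ.map_source hθ.1
  map_target' z hz := ⟨by rw [planeOfSlope_of_mem hφ hz]; exact φ.map_target hz,
    z.2, hasSlope_planeOfSlope hφ hz⟩
  left_inv' θ hθ := by
    have h1 := hasSlope_planeOfSlope hφ (z := (φ θ.pt, slope φ θ)) (φ.map_source hθ.1)
    have h2 : (planeOfSlope φ hφ (φ θ.pt, slope φ θ)).pt = θ.pt := by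
      rw [planeOfSlope_of_mem hφ (φ.map_source hθ.1)]; exact φ.left_inv hθ.1
    exact (GrassmannBundle.eq_of_hasSlope hφ hθ.1 h2.symm (hasSlope_slope hθ.2) h1).symm
  right_inv' z hz := Prod.ext
    (by rw [planeOfSlope_of_mem hφ hz]; exact φ.right_inv hz)
    (hasSlope_planeOfSlope hφ hz).slope_eq

/-- The derivative of a change of divided charts. -/
def changeDeriv (φ ψ : OpenPartialHomeomorph E (Model n m)) (u : Model n m) :
    Model n m →L[ℝ] Model n m := fderiv ℝ (ψ ∘ φ.symm) u

theorem changeDeriv_eq {φ ψ : OpenPartialHomeomorph E (Model n m)}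
    (hφ : φ ∈ IsManifold.maximalAtlas 𝓘(ℝ, Model n m) ∞ E)
    (hψ : ψ ∈ IsManifold.maximalAtlas 𝓘(ℝ, Model n m) ∞ E) {u : Model n m}
    (hu : u ∈ (φ.symm.trans ψ).source) :
    changeDeriv φ ψ u = (dChart ψ (φ.symm u)).comp (dChartSymm φ u) := by
  rw [OpenPartialHomeomorph.trans_source] at hu
  have h : HasFDerivAt (ψ ∘ φ.symm) ((dChart ψ (φ.symm u)).comp (dChartSymm φ u) :
      Model n m →L[ℝ] Model n m) u :=
    hasMFDerivAt_iff_hasFDerivAt.1 ((mdiff_of_mem hψ hu.2).hasMFDerivAt.comp u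
      (mdiff_symm_of_mem hφ hu.1).hasMFDerivAt)
  exact h.fderiv

theorem contDiffOn_change [IsManifold 𝓘(ℝ, Model n m) ∞ E]
    {φ ψ : OpenPartialHomeomorph E (Model n m)}
    (hφ : φ ∈ IsManifold.maximalAtlas 𝓘(ℝ, Model n m) ∞ E)
    (hψ : ψ ∈ IsManifold.maximalAtlas 𝓘(ℝ, Model n m) ∞ E) :
    ContDiffOn ℝ ∞ (ψ ∘ φ.symm) (φ.symm.trans ψ).source := by
  rw [← contMDiffOn_iff_contDiffOn, OpenPartialHomeomorph.trans_source]
  exact (contMDiffOn_of_mem_maximalAtlas hψ).comp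
    ((contMDiffOn_symm_of_mem_maximalAtlas hφ).mono inter_subset_left) inter_subset_right

theorem contDiffOn_changeDeriv [IsManifold 𝓘(ℝ, Model n m) ∞ E]
    {φ ψ : OpenPartialHomeomorph E (Model n m)}
    (hφ : φ ∈ IsManifold.maximalAtlas 𝓘(ℝ, Model n m) ∞ E)
    (hψ : ψ ∈ IsManifold.maximalAtlas 𝓘(ℝ, Model n m) ∞ E) :
    ContDiffOn ℝ ∞ (changeDeriv φ ψ) (φ.symm.trans ψ).source :=
  (contDiffOn_change hφ hψ).fderiv_of_isOpen (φ.symm.trans ψ).open_source (by simp)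

theorem map_plane_planeOfSlope {φ ψ : OpenPartialHomeomorph E (Model n m)}
    (hφ : φ ∈ IsManifold.maximalAtlas 𝓘(ℝ, Model n m) ∞ E)
    (hψ : ψ ∈ IsManifold.maximalAtlas 𝓘(ℝ, Model n m) ∞ E) {z : GrassmannModel n m}
    (hz : z.1 ∈ (φ.symm.trans ψ).source)
    (B : EuclideanSpace ℝ (Fin n) →L[ℝ] EuclideanSpace ℝ (Fin m)) :
    HasSlope ψ (planeOfSlope φ hφ z) B ↔
      z.2.toLinearMap.graph.map (changeDeriv φ ψ z.1).toLinearMap = B.toLinearMap.graph := by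
  rw [changeDeriv_eq hφ hψ hz]
  rw [OpenPartialHomeomorph.trans_source] at hz
  rw [planeOfSlope_of_mem hφ hz.1]
  unfold HasSlope
  rw [← Submodule.map_comp]
  rfl

theorem source_change [IsManifold 𝓘(ℝ, Model n m) ∞ E]
    {φ ψ : OpenPartialHomeomorph E (Model n m)}
    (hφ : φ ∈ IsManifold.maximalAtlas 𝓘(ℝ, Model n m) ∞ E)
    (hψ : ψ ∈ IsManifold.maximalAtlas 𝓘(ℝ, Model n m) ∞ E) :
    ((grassmannChart φ hφ).symm.trans (grassmannChart ψ hψ)).source =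
      {z | z.1 ∈ (φ.symm.trans ψ).source ∧ IsUnit (graphFst (changeDeriv φ ψ z.1) z.2)} := by
  ext z
  have hpt (hz : z.1 ∈ φ.target) : (planeOfSlope φ hφ z).pt = φ.symm z.1 := by
    rw [planeOfSlope_of_mem hφ hz]
  have key (hz : z.1 ∈ (φ.symm.trans ψ).source) : (∃ A, HasSlope ψ (planeOfSlope φ hφ z) A) ↔
      IsUnit (graphFst (changeDeriv φ ψ z.1) z.2) := by
    rw [← exists_map_graph_iff]
    exact exists_congr fun B => map_plane_planeOfSlope hφ hψ hz B
  constructor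
  · rintro ⟨h1, h2, h3⟩
    have hz : z.1 ∈ (φ.symm.trans ψ).source := by
      rw [OpenPartialHomeomorph.trans_source]; exact ⟨h1, (hpt h1).subst (motive := (· ∈ ψ.source)) h2⟩
    exact ⟨hz, (key hz).1 h3⟩
  · rintro ⟨hz, h3⟩
    have hz' := hz
    rw [OpenPartialHomeomorph.trans_source] at hz'
    exact ⟨hz'.1, (hpt hz'.1).symm ▸ hz'.2, (key hz).2 h3⟩

theorem contDiffOn_graphFst [IsManifold 𝓘(ℝ, Model n m) ∞ E]
    {φ ψ : OpenPartialHomeomorph E (Model n m)}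
    (hφ : φ ∈ IsManifold.maximalAtlas 𝓘(ℝ, Model n m) ∞ E)
    (hψ : ψ ∈ IsManifold.maximalAtlas 𝓘(ℝ, Model n m) ∞ E) :
    ContDiffOn ℝ ∞ (fun z : GrassmannModel n m => graphFst (changeDeriv φ ψ z.1) z.2)
      {z | z.1 ∈ (φ.symm.trans ψ).source} := by
  have h1 : ContDiffOn ℝ ∞ (fun z : GrassmannModel n m => changeDeriv φ ψ z.1)
      {z | z.1 ∈ (φ.symm.trans ψ).source} :=
    (contDiffOn_changeDeriv hφ hψ).comp contDiff_fst.contDiffOn fun z hz => hz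
  have h2 : ContDiffOn ℝ ∞ (fun z : GrassmannModel n m => graphEmb z.2)
      {z | z.1 ∈ (φ.symm.trans ψ).source} :=
    (contDiff_const.add ((contDiff_const (c := ContinuousLinearMap.inr ℝ
      (EuclideanSpace ℝ (Fin n)) (EuclideanSpace ℝ (Fin m)))).clm_comp contDiff_snd)).contDiffOn
  exact contDiffOn_const.clm_comp (h1.clm_comp h2)

theorem contDiffOn_graphSnd [IsManifold 𝓘(ℝ, Model n m) ∞ E]
    {φ ψ : OpenPartialHomeomorph E (Model n m)}
    (hφ : φ ∈ IsManifold.maximalAtlas 𝓘(ℝ, Model n m) ∞ E)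
    (hψ : ψ ∈ IsManifold.maximalAtlas 𝓘(ℝ, Model n m) ∞ E) :
    ContDiffOn ℝ ∞ (fun z : GrassmannModel n m => graphSnd (changeDeriv φ ψ z.1) z.2)
      {z | z.1 ∈ (φ.symm.trans ψ).source} := by
  have h1 : ContDiffOn ℝ ∞ (fun z : GrassmannModel n m => changeDeriv φ ψ z.1)
      {z | z.1 ∈ (φ.symm.trans ψ).source} :=
    (contDiffOn_changeDeriv hφ hψ).comp contDiff_fst.contDiffOn fun z hz => hz
  have h2 : ContDiffOn ℝ ∞ (fun z : GrassmannModel n m => graphEmb z.2)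
      {z | z.1 ∈ (φ.symm.trans ψ).source} :=
    (contDiff_const.add ((contDiff_const (c := ContinuousLinearMap.inr ℝ
      (EuclideanSpace ℝ (Fin n)) (EuclideanSpace ℝ (Fin m)))).clm_comp contDiff_snd)).contDiffOn
  exact contDiffOn_const.clm_comp (h1.clm_comp h2)

theorem contDiffOn_chartChange [IsManifold 𝓘(ℝ, Model n m) ∞ E]
    {φ ψ : OpenPartialHomeomorph E (Model n m)}
    (hφ : φ ∈ IsManifold.maximalAtlas 𝓘(ℝ, Model n m) ∞ E)
    (hψ : ψ ∈ IsManifold.maximalAtlas 𝓘(ℝ, Model n m) ∞ E) :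
    ContDiffOn ℝ ∞ ((grassmannChart φ hφ).symm.trans (grassmannChart ψ hψ))
      ((grassmannChart φ hφ).symm.trans (grassmannChart ψ hψ)).source := by
  have hsub : ((grassmannChart φ hφ).symm.trans (grassmannChart ψ hψ)).source ⊆
      {z | z.1 ∈ (φ.symm.trans ψ).source} := by
    rw [source_change]; exact fun z hz => hz.1
  have h1 : ContDiffOn ℝ ∞ (fun z : GrassmannModel n m => (ψ ∘ φ.symm) z.1)
      ((grassmannChart φ hφ).symm.trans (grassmannChart ψ hψ)).source :=
    (contDiffOn_change hφ hψ).comp contDiff_fst.contDiffOn fun z hz => hsub hz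
  have h2 : ContDiffOn ℝ ∞ (fun z : GrassmannModel n m =>
      (graphSnd (changeDeriv φ ψ z.1) z.2).comp
        (Ring.inverse (graphFst (changeDeriv φ ψ z.1) z.2)))
      ((grassmannChart φ hφ).symm.trans (grassmannChart ψ hψ)).source := by
    refine ((contDiffOn_graphSnd hφ hψ).mono hsub).clm_comp fun z hz => ?_
    have hz' := hz
    rw [source_change] at hz'
    obtain ⟨u, hu⟩ := hz'.2
    have h3 := (contDiffOn_graphFst hφ hψ).mono hsub z hz
    have h4 : ContDiffAt ℝ ∞ (Ring.inverse (M₀ :=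
        EuclideanSpace ℝ (Fin n) →L[ℝ] EuclideanSpace ℝ (Fin n)))
        (graphFst (changeDeriv φ ψ z.1) z.2) := hu ▸ contDiffAt_ringInverse ℝ u
    exact h4.comp_contDiffWithinAt z h3
  refine (h1.prodMk h2).congr fun z hz => ?_
  have hz' := hz
  rw [source_change] at hz'
  have hz1 : z.1 ∈ φ.target := hz.1
  refine Prod.ext ?_ ?_
  · change ψ (planeOfSlope φ hφ z).pt = ψ (φ.symm z.1)
    rw [planeOfSlope_of_mem hφ hz1]
  exact eq_of_map_graph hz'.2
    ((map_plane_planeOfSlope hφ hψ hz'.1 _).1 (hasSlope_slope hz.2.2))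

theorem isOpen_source_change [IsManifold 𝓘(ℝ, Model n m) ∞ E]
    {φ ψ : OpenPartialHomeomorph E (Model n m)}
    (hφ : φ ∈ IsManifold.maximalAtlas 𝓘(ℝ, Model n m) ∞ E)
    (hψ : ψ ∈ IsManifold.maximalAtlas 𝓘(ℝ, Model n m) ∞ E) :
    IsOpen ((grassmannChart φ hφ).symm.trans (grassmannChart ψ hψ)).source := by
  rw [source_change]
  have h : IsOpen {z : GrassmannModel n m | z.1 ∈ (φ.symm.trans ψ).source} :=
    (φ.symm.trans ψ).open_source.preimage continuous_fst
  exact (contDiffOn_graphFst hφ hψ).continuousOn.isOpen_inter_preimage h Units.isOpen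

/-- Every `n`-plane of the model space is carried to a graph by a linear automorphism. -/
theorem exists_linear_graph (W : Submodule ℝ (Model n m)) (hW : Module.finrank ℝ W = n) :
    ∃ G : Model n m ≃L[ℝ] Model n m, W.map G.toLinearEquiv.toLinearMap =
      (0 : EuclideanSpace ℝ (Fin n) →L[ℝ] EuclideanSpace ℝ (Fin m)).toLinearMap.graph := by
  obtain ⟨C, hC⟩ := W.exists_isCompl
  have hC' : Module.finrank ℝ C = m := by
    have := Submodule.finrank_add_eq_of_isCompl hC
    simp [hW, Module.finrank_prod] at this
    omega
  let e1 : W ≃ₗ[ℝ] EuclideanSpace ℝ (Fin n) :=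
    LinearEquiv.ofFinrankEq _ _ (by rw [hW, finrank_euclideanSpace_fin])
  let e2 : C ≃ₗ[ℝ] EuclideanSpace ℝ (Fin m) :=
    LinearEquiv.ofFinrankEq _ _ (by rw [hC', finrank_euclideanSpace_fin])
  let G : Model n m ≃ₗ[ℝ] Model n m :=
    (Submodule.prodEquivOfIsCompl W C hC).symm.trans (e1.prodCongr e2)
  refine ⟨G.toContinuousLinearEquiv, ?_⟩
  have key (w : W) : G w = (e1 w, 0) := by simp [G]
  ext ⟨a, b⟩
  constructor
  · rintro ⟨w, hw, e⟩
    have := (key ⟨w, hw⟩).symm.trans e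
    simpa using (congrArg Prod.snd this).symm
  · intro hb
    obtain rfl : b = 0 := by simpa using hb
    exact ⟨e1.symm a, (e1.symm a).2, (key _).trans (by simp)⟩

theorem exists_dividedChart [IsManifold 𝓘(ℝ, Model n m) ∞ E] (θ : GrassmannBundle n m E) :
    ∃ φ : OpenPartialHomeomorph E (Model n m),
      φ ∈ IsManifold.maximalAtlas 𝓘(ℝ, Model n m) ∞ E ∧ θ.pt ∈ φ.source ∧
      ∃ A, HasSlope φ θ A := by
  let c := chartAt (Model n m) θ.pt
  have hc : c ∈ IsManifold.maximalAtlas 𝓘(ℝ, Model n m) ∞ E :=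
    IsManifold.chart_mem_maximalAtlas θ.pt
  have hcs : θ.pt ∈ c.source := mem_chart_source _ _
  obtain ⟨G, hG⟩ := exists_linear_graph (θ.plane.map (dChart c θ.pt).toLinearMap) (by
    rw [← LinearEquiv.finrank_eq (Submodule.equivMapOfInjective
      (dChart c θ.pt).toLinearMap (dChart_injective hc hcs) θ.plane), θ.finrank_plane])
  let φ := c.trans G.toHomeomorph.toOpenPartialHomeomorph
  have hφ : φ ∈ IsManifold.maximalAtlas 𝓘(ℝ, Model n m) ∞ E := by
    apply OpenPartialHomeomorph.mem_maximalAtlas_of_contMDiffOn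
    · have : ContMDiffOn 𝓘(ℝ, Model n m) 𝓘(ℝ, Model n m) ∞ (G ∘ c) c.source :=
        G.contDiff.contMDiff.comp_contMDiffOn (contMDiffOn_of_mem_maximalAtlas hc)
      simpa [φ] using this
    · have : ContMDiffOn 𝓘(ℝ, Model n m) 𝓘(ℝ, Model n m) ∞ (c.symm ∘ G.symm)
          (G.symm ⁻¹' c.target) :=
        (contMDiffOn_symm_of_mem_maximalAtlas hc).comp G.symm.contDiff.contMDiff.contMDiffOn
          fun z hz => hz
      simpa [φ] using this
  refine ⟨φ, hφ, by simpa [φ] using hcs, 0, ?_⟩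
  have hd : dChart φ θ.pt = (G : Model n m →L[ℝ] Model n m).comp (dChart c θ.pt) := by
    have h1 : HasMFDerivAt 𝓘(ℝ, Model n m) 𝓘(ℝ, Model n m) G (c θ.pt)
        (G : Model n m →L[ℝ] Model n m) := G.hasFDerivAt.hasMFDerivAt
    exact (h1.comp θ.pt (mdiff_of_mem hc hcs).hasMFDerivAt).mfderiv
  unfold HasSlope
  rw [hd, ← hG]
  exact Submodule.map_comp _ _ _

/-- The atlas of `J^1(E,n)` made of the charts induced by all divided charts of `E`. -/
def grassmannCore [IsManifold 𝓘(ℝ, Model n m) ∞ E] :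
    ChartedSpaceCore (GrassmannModel n m) (GrassmannBundle n m E) where
  atlas := {e | ∃ (φ : OpenPartialHomeomorph E (Model n m))
    (hφ : φ ∈ IsManifold.maximalAtlas 𝓘(ℝ, Model n m) ∞ E), e = grassmannChart φ hφ}
  chartAt θ := grassmannChart (exists_dividedChart θ).choose
    (exists_dividedChart θ).choose_spec.1
  mem_chart_source θ := (exists_dividedChart θ).choose_spec.2
  chart_mem_atlas θ := ⟨_, _, rfl⟩
  open_source := by
    rintro _ _ ⟨φ, hφ, rfl⟩ ⟨ψ, hψ, rfl⟩
    exact isOpen_source_change hφ hψ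
  continuousOn_toFun := by
    rintro _ _ ⟨φ, hφ, rfl⟩ ⟨ψ, hψ, rfl⟩
    exact (contDiffOn_chartChange hφ hψ).continuousOn

instance [IsManifold 𝓘(ℝ, Model n m) ∞ E] : TopologicalSpace (GrassmannBundle n m E) :=
  grassmannCore.toTopologicalSpace

instance [IsManifold 𝓘(ℝ, Model n m) ∞ E] :
    ChartedSpace (GrassmannModel n m) (GrassmannBundle n m E) :=
  grassmannCore.toChartedSpace

instance [IsManifold 𝓘(ℝ, Model n m) ∞ E] :
    IsManifold 𝓘(ℝ, GrassmannModel n m) ∞ (GrassmannBundle n m E) := by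
  apply isManifold_of_contDiffOn
  intro e e' he he'
  obtain ⟨_, ⟨φ, rfl⟩, hφ⟩ := he
  obtain ⟨_, ⟨⟨φ, hφ', rfl⟩, rfl⟩, rfl⟩ := hφ
  obtain ⟨_, ⟨ψ, rfl⟩, hψ⟩ := he'
  obtain ⟨_, ⟨⟨ψ, hψ', rfl⟩, rfl⟩, rfl⟩ := hψ
  simpa using! contDiffOn_chartChange hφ' hψ'

end GrassmannCharts

section Connections

variable {n m : ℕ} {E : Type*} [TopologicalSpace E] [ChartedSpace (Model n m) E]
  [IsManifold 𝓘(ℝ, Model n m) ∞ E]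

variable (n m E) in
/-- Linear connections on `TE → E`, given by their covariant derivative. -/
abbrev LinearConnection : Type _ :=
  CovariantDerivative 𝓘(ℝ, Model n m) (Model n m)
    (fun p : E => TangentSpace 𝓘(ℝ, Model n m) p)

/-- The vertical projection `υ_Γ : T(TE) → TE` of `Γ`. In a local trivialization of `TE` with
basis `p_k` and fibre coordinates `η^k` it is `(dη^k + Γ_A^k_B η^B du^A) ⊗ p_k`: the second term is
the covariant derivative of the vector field with the same, constant, components as `w`. -/
def verticalProj (Γ : LinearConnection n m E) (w : TangentBundle 𝓘(ℝ, Model n m) E)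
    (ξ : TangentSpace 𝓘(ℝ, Model n m).tangent w) : TangentSpace 𝓘(ℝ, Model n m) w.proj :=
  let e := trivializationAt (Model n m)
    (fun p : E => TangentSpace 𝓘(ℝ, Model n m) p) w.proj
  e.symm w.proj
      (mfderiv 𝓘(ℝ, Model n m).tangent 𝓘(ℝ, Model n m) (fun w' => (e w').2) w ξ) +
    Γ (fun q => e.symm q (e w).2) w.proj
      (mfderiv 𝓘(ℝ, Model n m).tangent 𝓘(ℝ, Model n m)
        (fun w' : TangentBundle 𝓘(ℝ, Model n m) E => w'.proj) w ξ)

/-- The covariant derivative `∇[f^*Γ]_v s = υ_Γ (Ts (v))` of the pull-back connection on the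
pull-back bundle `f^*(TE)`, for a section `s` of it, that is a vector field along `f : N → E`. -/
def pullbackCov (Γ : LinearConnection n m E) {B N : Type*} [NormedAddCommGroup B]
    [NormedSpace ℝ B] [TopologicalSpace N] [ChartedSpace B N] (f : N → E)
    (s : ∀ y, TangentSpace 𝓘(ℝ, Model n m) (f y)) (y : N) (v : TangentSpace 𝓘(ℝ, B) y) :
    TangentSpace 𝓘(ℝ, Model n m) (f y) :=
  verticalProj Γ ⟨f y, s y⟩ (mfderiv 𝓘(ℝ, B) 𝓘(ℝ, Model n m).tangent
    (fun y' => (⟨f y', s y'⟩ : TangentBundle 𝓘(ℝ, Model n m) E)) y v)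

/-! ### The equation of totally geodesic submanifolds -/

/-- `Y` is a vector field, smooth at the base point `p` of `P` and tangent to the submanifold `L`
at the points of `L` near `p`. -/
structure PointedSubmanifold.IsTangentField (P : PointedSubmanifold n m E)
    (Y : ∀ q : E, TangentSpace 𝓘(ℝ, Model n m) q) : Prop where
  contMDiffAt : ContMDiffAt 𝓘(ℝ, Model n m) 𝓘(ℝ, Model n m).tangent ∞
    (fun q => (⟨q, Y q⟩ : TangentBundle 𝓘(ℝ, Model n m) E)) P.pt
  tangent : ∀ᶠ q in 𝓝 P.pt, q ∈ P.carrier → Y q ∈ tangentPlane (Model n m) P.carrier q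

/-- The second fundamental form `II_L(X, Y) = ω(∇_X Y) ∈ T_pE / T_pL` of `L` at `p`, where
`X ∈ T_pL` and `Y` is a vector field tangent to `L`. It is the value at `[L]^2_p` of the universal
second fundamental form on `J^2(E,n)`. -/
def secondFundamentalForm (Γ : LinearConnection n m E) (P : PointedSubmanifold n m E)
    (X : tangentPlane (Model n m) P.carrier P.pt)
    (Y : ∀ q : E, TangentSpace 𝓘(ℝ, Model n m) q) :
    TangentSpace 𝓘(ℝ, Model n m) P.pt ⧸ tangentPlane (Model n m) P.carrier P.pt :=
  (tangentPlane (Model n m) P.carrier P.pt).mkQ (Γ Y P.pt X)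

/-- The equation `II = 0` of (unparametrized) `n`-dimensional totally geodesic submanifolds, a
subset of `J^2(E,n)`. -/
def totallyGeodesicEquation (Γ : LinearConnection n m E) : Set (Jet n m E 2) :=
  {j | ∃ P : PointedSubmanifold n m E, P.jet 2 = j ∧
    ∀ X Y, P.IsTangentField Y → secondFundamentalForm Γ P X Y = 0}

/-- Two connections are `n`-Grassmannian equivalent if they have the same equation of
`n`-dimensional totally geodesic submanifolds. -/
def IsGrassmannianEquivalent (Γ Γ' : LinearConnection n m E) : Prop :=
  totallyGeodesicEquation Γ = totallyGeodesicEquation Γ'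

/-! ### The connection on `π_{1,0}` and the associated section of `π_{2,1}` -/

/-- `Y` is a section of the tautological subbundle `H^{1,0} = {(θ, w) | w ∈ θ}` of the pull-back
`T^{1,0}` of `TE` to `J^1(E,n)`, and it is smooth at `θ`. -/
structure IsTautologicalSectionAt (Y : ∀ θ : GrassmannBundle n m E,
    TangentSpace 𝓘(ℝ, Model n m) θ.pt) (θ : GrassmannBundle n m E) : Prop where
  mem_plane : ∀ θ', Y θ' ∈ θ'.plane
  contMDiffAt : ContMDiffAt 𝓘(ℝ, GrassmannModel n m) 𝓘(ℝ, Model n m).tangent ∞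
    (fun θ' => (⟨θ'.pt, Y θ'⟩ : TangentBundle 𝓘(ℝ, Model n m) E)) θ

/-- The vertical projection `TJ^1(E,n) → Hom(H^{1,0}, V^{1,0})`, `V^{1,0} = T^{1,0} / H^{1,0}`, of
the connection `Γ̇` on `π_{1,0}` induced by `Γ`: at `v ∈ T_θ J^1(E,n)` and at the value at `θ` of a
section `Y` of `H^{1,0}` it is `ω(∇_v (D Y))`, where `D : H^{1,0} → T^{1,0}` is the inclusion,
`∇` is the pull-back of `Γ` and `ω : T^{1,0} → V^{1,0}` is the quotient map. If `Ξ` is any linear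
connection on `H^{1,0}`, then `(∇_v D)(Y) = ∇_v (D Y) - D (∇[Ξ]_v Y)`, where the last term is
killed by `ω`; so this is `ω ∘ (∇_v D)`. -/
def dotVerticalProj (Γ : LinearConnection n m E) (θ : GrassmannBundle n m E)
    (v : TangentSpace 𝓘(ℝ, GrassmannModel n m) θ)
    (Y : ∀ θ : GrassmannBundle n m E, TangentSpace 𝓘(ℝ, Model n m) θ.pt) :
    TangentSpace 𝓘(ℝ, Model n m) θ.pt ⧸ θ.plane :=
  θ.plane.mkQ (pullbackCov Γ GrassmannBundle.pt Y θ v)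

/-- `v` is a horizontal lift of `w ∈ T_pE` to `θ ∈ J^1(E,n)`, `p = π_{1,0}(θ)`, with respect to
`Γ̇`. -/
def IsHorizontalLift (Γ : LinearConnection n m E) (θ : GrassmannBundle n m E)
    (w : TangentSpace 𝓘(ℝ, Model n m) θ.pt)
    (v : TangentSpace 𝓘(ℝ, GrassmannModel n m) θ) : Prop :=
  mfderiv 𝓘(ℝ, GrassmannModel n m) 𝓘(ℝ, Model n m) GrassmannBundle.pt θ v = w ∧
    ∀ Y, IsTautologicalSectionAt Y θ → dotVerticalProj Γ θ v Y = 0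

/-- The first prolongation `L^{(1)} = {[L]^1_q | q ∈ L}` of the submanifold `L`. -/
def PointedSubmanifold.prolongation (P : PointedSubmanifold n m E) :
    Set (GrassmannBundle n m E) :=
  {θ | θ.pt ∈ P.carrier ∧ θ.plane = tangentPlane (Model n m) P.carrier θ.pt}

/-- The `R`-plane `R_{[L]^2_p} = T_{[L]^1_p} L^{(1)}`. -/
def PointedSubmanifold.rPlane (P : PointedSubmanifold n m E) :
    Submodule ℝ (TangentSpace 𝓘(ℝ, GrassmannModel n m) P.jet1) :=
  tangentPlane (GrassmannModel n m) P.prolongation P.jet1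

/-- `s` is the section `Γ̈` of `π_{2,1}` associated with `Γ`, that is the `n`-Grassmannian structure
of `Γ`: with `Γ̈(θ) = [L]^2_p`, the inclusion `D² : θ = T_pL ≃ R_{Γ̈(θ)} → T_θ J^1(E,n)` sends every
`w ∈ θ` to its `Γ̇`-horizontal lift (`D² ∘ Γ̈ = D¹ ⌟ Γ̇`). Here `D²(w)` is the vector of the `R`-plane
that projects to `w`. -/
def IsGrassmannianStructure (Γ : LinearConnection n m E)
    (s : GrassmannBundle n m E → Jet n m E 2) : Prop :=
  ∀ θ, jetProj (s θ) = θ ∧ ∃ P : PointedSubmanifold n m E, P.jet 2 = s θ ∧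
    ∀ w ∈ P.jet1.plane, ∃ v ∈ P.rPlane, IsHorizontalLift Γ P.jet1 w v

end Connections
end
end SubmanifoldJet

/-!
Let `L` be a submanifold through `p`. The prolongation `q ↦ T_q L` is a section of `π_{1,0}` over
`L`, so `R_{[L]²}` is the image of `T_p L` under its differential. By the chain rule for pullback
connections, the vertical projection of the image of `X ∈ T_p L`, applied to a section `Y` of the
tautological bundle, is the second fundamental form of `L` at `X` and the field `q ↦ Y (T_q L)`.
Hence `R_{[L]²}` consists of horizontal lifts if and only if `[L]²` is in the equation of totally
geodesic submanifolds, and the `n`-Grassmannian structures are the sections of `π_{2,1}` with values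
in this equation.

In a divided chart in which `L` is the graph of `f`, the second fundamental form vanishes at `p` if
and only if the second derivative of `f` is opposite to the Christoffel form of `Γ` on `T_p L` taken
modulo `T_p L`. So at most one `2`-jet over each plane satisfies the equation, and exactly one if
that form is symmetric, that is, if the torsion of `Γ` maps pairs of vectors of the plane into it.
The equation is then the image of the `n`-Grassmannian structure, and a section of `π_{2,1}` is
determined by its image.
-/

namespace SubmanifoldJet
noncomputable section

section TangentMaps

variable {𝕜 : Type*} [NontriviallyNormedField 𝕜]
  {B : Type*} [NormedAddCommGroup B] [NormedSpace 𝕜 B] {H : Type*} [TopologicalSpace H]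
  {I : ModelWithCorners 𝕜 B H} {M : Type*} [TopologicalSpace M] [ChartedSpace H M]

theorem tangentBundle_mk_congr {p q : M} (h : p = q) {v : TangentSpace I p} {w : TangentSpace I q}
    (hvw : (show B from v) = w) : (⟨p, v⟩ : TangentBundle I M) = ⟨q, w⟩ := by
  subst h
  exact congrArg _ hvw

theorem contMDiffAt_tangentMap [IsManifold I 1 M] {B' : Type*} [NormedAddCommGroup B']
    [NormedSpace 𝕜 B'] {H' : Type*} [TopologicalSpace H'] {I' : ModelWithCorners 𝕜 B' H'}
    {M' : Type*} [TopologicalSpace M'] [ChartedSpace H' M'] [IsManifold I' 1 M']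
    {k l : WithTop ℕ∞} (hkl : k + 1 ≤ l) {f : M → M'} {U : Set M} (hU : IsOpen U)
    (hf : ContMDiffOn I I' l f U) {w : TangentBundle I M} (hw : w.proj ∈ U) :
    ContMDiffAt I.tangent I'.tangent k (tangentMap I I' f) w := by
  have hopen : IsOpen (TotalSpace.proj ⁻¹' U : Set (TangentBundle I M)) :=
    hU.preimage (FiberBundle.continuous_proj B _)
  refine ((hf.contMDiffOn_tangentMapWithin hkl hU.uniqueMDiffOn).contMDiffAt
    (hopen.mem_nhds hw)).congr_of_eventuallyEq ?_
  filter_upwards [hopen.mem_nhds hw] with x hx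
  simp only [tangentMap, tangentMapWithin, mfderivWithin_of_isOpen hU hx]

end TangentMaps

section ChartFrame

variable {n m : ℕ} {E : Type*} [TopologicalSpace E] [ChartedSpace (Model n m) E]
  {φ : OpenPartialHomeomorph E (Model n m)}

/-- The coordinate frame of the divided chart `φ` at `q`: it sends `c` to the tangent vector at `q`
with components `c`. For fixed `c`, `fun q ↦ chartFrame φ q c` is the vector field with constant
components `c`. -/
def chartFrame (φ : OpenPartialHomeomorph E (Model n m)) (q : E) :
    Model n m →L[ℝ] TangentSpace 𝓘(ℝ, Model n m) q := dChartSymm φ (φ q)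

theorem chartFrame_dChart (hφ : φ ∈ IsManifold.maximalAtlas 𝓘(ℝ, Model n m) ∞ E) {q : E}
    (hq : q ∈ φ.source) (v : TangentSpace 𝓘(ℝ, Model n m) q) :
    chartFrame φ q (dChart φ q v) = v :=
  dChartSymm_dChart hφ hq v

theorem dChart_chartFrame (hφ : φ ∈ IsManifold.maximalAtlas 𝓘(ℝ, Model n m) ∞ E) {q : E}
    (hq : q ∈ φ.source) (c : Model n m) : dChart φ q (chartFrame φ q c) = c := by
  have := dChart_dChartSymm hφ (φ.map_source hq) c
  rw [φ.left_inv hq] at this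
  exact this

variable [IsManifold 𝓘(ℝ, Model n m) ∞ E]

/-- Differentiability at `p` of the vector field `σ`, seen as a section of `TE`. -/
abbrev FieldMDiffAt (σ : ∀ q : E, TangentSpace 𝓘(ℝ, Model n m) q) (p : E) : Prop :=
  MDifferentiableAt 𝓘(ℝ, Model n m) 𝓘(ℝ, Model n m).tangent
    (fun q => (⟨q, σ q⟩ : TangentBundle 𝓘(ℝ, Model n m) E)) p

variable {B N : Type*} [NormedAddCommGroup B] [NormedSpace ℝ B] [TopologicalSpace N]
  [ChartedSpace B N]

theorem contMDiffAt_chartFrame (hφ : φ ∈ IsManifold.maximalAtlas 𝓘(ℝ, Model n m) ∞ E) {g : N → E}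
    {h : N → Model n m} {y : N} (hg : ContMDiffAt 𝓘(ℝ, B) 𝓘(ℝ, Model n m) ∞ g y)
    (hy : g y ∈ φ.source) (hh : ContMDiffAt 𝓘(ℝ, B) 𝓘(ℝ, Model n m) ∞ h y) :
    ContMDiffAt 𝓘(ℝ, B) 𝓘(ℝ, Model n m).tangent ∞
      (fun z => (⟨g z, chartFrame φ (g z) (h z)⟩ : TangentBundle 𝓘(ℝ, Model n m) E)) y := by
  have : IsManifold 𝓘(ℝ, Model n m) 1 E := .of_le (n := ∞) (by simp)
  have hcoord : ContMDiffAt 𝓘(ℝ, B) 𝓘(ℝ, Model n m).tangent ∞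
      (fun z => (⟨φ (g z), h z⟩ : TangentBundle 𝓘(ℝ, Model n m) (Model n m))) y := by
    rw [contMDiffAt_totalSpace]
    exact ⟨(contMDiffAt_of_mem_maximalAtlas hφ hy).comp y hg, by simpa using hh⟩
  refine ((contMDiffAt_tangentMap (l := ∞) (by simp) φ.open_target
    (contMDiffOn_symm_of_mem_maximalAtlas hφ) (w := ⟨φ (g y), h y⟩)
    (φ.map_source hy)).comp y hcoord).congr_of_eventuallyEq ?_
  filter_upwards [hg.continuousAt.eventually (φ.open_source.mem_nhds hy)] with z hz
  exact tangentBundle_mk_congr (φ.left_inv hz).symm rfl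

theorem contMDiffAt_dChart (hφ : φ ∈ IsManifold.maximalAtlas 𝓘(ℝ, Model n m) ∞ E)
    {w : TangentBundle 𝓘(ℝ, Model n m) E} (hw : w.proj ∈ φ.source) :
    ContMDiffAt 𝓘(ℝ, Model n m).tangent 𝓘(ℝ, Model n m) ∞
      (fun w' : TangentBundle 𝓘(ℝ, Model n m) E => dChart φ w'.proj w'.2) w := by
  have : IsManifold 𝓘(ℝ, Model n m) 1 E := .of_le (n := ∞) (by simp)
  exact (contMDiff_snd_tangentBundle_modelSpace (Model n m) 𝓘(ℝ, Model n m)).contMDiffAt.comp w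
    (contMDiffAt_tangentMap (l := ∞) (by simp) φ.open_source
      (contMDiffOn_of_mem_maximalAtlas hφ) hw)

theorem mdifferentiableAt_dChart (hφ : φ ∈ IsManifold.maximalAtlas 𝓘(ℝ, Model n m) ∞ E)
    {σ : ∀ q : E, TangentSpace 𝓘(ℝ, Model n m) q} {p : E} (hp : p ∈ φ.source)
    (hσ : FieldMDiffAt σ p) :
    MDifferentiableAt 𝓘(ℝ, Model n m) 𝓘(ℝ, Model n m) (fun q => dChart φ q (σ q)) p :=
  MDifferentiableAt.comp (g := fun w' : TangentBundle 𝓘(ℝ, Model n m) E => dChart φ w'.proj w'.2) p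
    ((contMDiffAt_dChart hφ (w := ⟨p, σ p⟩) hp).mdifferentiableAt (by simp)) hσ

end ChartFrame

section Components

variable {𝕜 : Type*} [NontriviallyNormedField 𝕜] [CompleteSpace 𝕜]
  {B : Type*} [NormedAddCommGroup B] [NormedSpace 𝕜 B] {H : Type*} [TopologicalSpace H]
  {I : ModelWithCorners 𝕜 B H} {M : Type*} [TopologicalSpace M] [ChartedSpace H M]
  {F : Type*} [NormedAddCommGroup F] [NormedSpace 𝕜 F] [FiniteDimensional 𝕜 F]
  {V : M → Type*} [TopologicalSpace (TotalSpace F V)] [∀ x, AddCommGroup (V x)]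
  [∀ x, Module 𝕜 (V x)] [∀ x, TopologicalSpace (V x)] [∀ x, IsTopologicalAddGroup (V x)]
  [∀ x, ContinuousSMul 𝕜 (V x)] [FiberBundle F V] [VectorBundle 𝕜 F V]
  [ContMDiffVectorBundle 1 F V I]
  {G : Type*} [NormedAddCommGroup G] [NormedSpace 𝕜 G]

/-- The difference of the two sides is tensorial in the section, so it may be evaluated on any
section `σ'` with the same value at `p`. -/
theorem map_cov_eq_mvfderiv_add (cov : CovariantDerivative I F V) {p : M} (D : ∀ q, V q →L[𝕜] G)
    (hD : ∀ σ : ∀ q, V q, MDiffAt (T% σ) p → MDifferentiableAt I 𝓘(𝕜, G) (fun q => D q (σ q)) p)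
    {σ σ' : ∀ q, V q} (hσ : MDiffAt (T% σ) p) (hσ' : MDiffAt (T% σ') p) (hval : σ p = σ' p) {c : G}
    (hconst : (fun q => D q (σ' q)) =ᶠ[𝓝 p] fun _ => c) (X : TangentSpace I p) :
    D p (cov σ p X) = mvfderiv I (fun q => D q (σ q)) p X + D p (cov σ' p X) := by
  have hcov := cov.isCovariantDerivativeOnUniv
  have htens : TensorialAt I F
      (fun σ => D p (cov σ p X) - mvfderiv I (fun q => D q (σ q)) p X) p := by
    refine ⟨fun {f σ} hf hσ => ?_, fun {σ σ'} hσ hσ' => ?_⟩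
    · have hfun : (fun q => D q ((f • σ) q)) = f • fun q => D q (σ q) :=
        funext fun q => map_smul (D q) (f q) (σ q)
      have hleib := congrArg (fun T => T X) (hcov.leibniz hσ hf)
      have hderiv := congrArg (fun T => T X) (mvfderiv_smul hf (hD σ hσ))
      simp only [add_apply, smul_apply, ContinuousLinearMap.smulRight_apply] at hleib hderiv
      rw [hfun, hleib, hderiv, map_add, map_smul, map_smul]
      module
    · have hfun : (fun q => D q ((σ + σ') q)) = (fun q => D q (σ q)) + fun q => D q (σ' q) :=
        funext fun q => map_add (D q) (σ q) (σ' q)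
      have hadd := congrArg (fun T => T X) (hcov.add hσ hσ')
      have hderiv := congrArg (fun T => T X) (mvfderiv_add (hD σ hσ) (hD σ' hσ'))
      simp only [add_apply] at hadd hderiv
      rw [hfun, hadd, hderiv, map_add]
      module
  have hconst' : mvfderiv I (fun q => D q (σ' q)) p = 0 :=
    (hconst.mfderiv_eq (I := I) (I' := 𝓘(𝕜, G))).trans (mvfderiv_const c)
  have hpoint := htens.pointwise hσ hσ' hval
  simp only [hconst', zero_apply, sub_zero] at hpoint
  rw [← hpoint]
  module

end Components

section PullbackConnection

variable {n m : ℕ} {E : Type*} [TopologicalSpace E] [ChartedSpace (Model n m) E]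
  [IsManifold 𝓘(ℝ, Model n m) ∞ E]

variable (n m) in
/-- The standard trivialization of `TE` at `p`, with respect to which `verticalProj` is defined. -/
abbrev tangentTriv (p : E) : Trivialization (Model n m)
    (TotalSpace.proj : TangentBundle 𝓘(ℝ, Model n m) E → E) :=
  trivializationAt (Model n m) (fun p : E => TangentSpace 𝓘(ℝ, Model n m) p) p

theorem cov_eq_symm_mvfderiv_add (Γ : LinearConnection n m E)
    {σ : ∀ q : E, TangentSpace 𝓘(ℝ, Model n m) q} {p : E} (hσ : FieldMDiffAt σ p)
    (X : TangentSpace 𝓘(ℝ, Model n m) p) :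
    Γ σ p X = (tangentTriv n m p).symm p
        (mvfderiv 𝓘(ℝ, Model n m) (fun q => (tangentTriv n m p ⟨q, σ q⟩).2) p X) +
      Γ (fun q => (tangentTriv n m p).symm q (tangentTriv n m p ⟨p, σ p⟩).2) p X := by
  have : IsManifold 𝓘(ℝ, Model n m) 1 E := .of_le (n := ∞) (by simp)
  set e := tangentTriv n m p
  have hp : p ∈ e.baseSet := FiberBundle.mem_baseSet_trivializationAt' p
  have hcomp (σ : ∀ q : E, TangentSpace 𝓘(ℝ, Model n m) q) :
      (fun q => e.continuousLinearMapAt ℝ q (σ q)) =ᶠ[𝓝 p] fun q => (e ⟨q, σ q⟩).2 := by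
    filter_upwards [e.open_baseSet.mem_nhds hp] with q hq
    rw [Trivialization.continuousLinearMapAt_apply, Trivialization.linearMapAt_apply, if_pos hq]
  have hconst : (fun q => (e ⟨q, e.symm q (e ⟨p, σ p⟩).2⟩).2) =ᶠ[𝓝 p] fun _ => (e ⟨p, σ p⟩).2 := by
    filter_upwards [e.open_baseSet.mem_nhds hp] with q hq
    rw [e.apply_mk_symm hq]
  have hconst_mdiff : FieldMDiffAt (fun q => e.symm q (e ⟨p, σ p⟩).2) p := by
    rw [FieldMDiffAt, mdifferentiableAt_totalSpace]
    exact ⟨mdifferentiableAt_id, mdifferentiableAt_const.congr_of_eventuallyEq hconst⟩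
  have hval : σ p = e.symm p (e ⟨p, σ p⟩).2 := (e.symm_proj_apply ⟨p, σ p⟩ hp).symm
  have hcov := map_cov_eq_mvfderiv_add Γ (fun q => e.continuousLinearMapAt ℝ q)
    (fun σ hσ => ((mdifferentiableAt_totalSpace _ _).1 hσ).2.congr_of_eventuallyEq (hcomp σ))
    hσ hconst_mdiff hval ((hcomp _).trans hconst) X
  have hderiv : mvfderiv 𝓘(ℝ, Model n m) (fun q => e.continuousLinearMapAt ℝ q (σ q)) p =
      mvfderiv 𝓘(ℝ, Model n m) (fun q => (e ⟨q, σ q⟩).2) p := (hcomp σ).mfderiv_eq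
  have hsymm := congrArg (e.symmL ℝ p) hcov
  rwa [map_add, e.symmL_continuousLinearMapAt hp, e.symmL_continuousLinearMapAt hp,
    Trivialization.symmL_apply _ hp, hderiv] at hsymm

theorem verticalProj_mfderiv (Γ : LinearConnection n m E)
    {σ : ∀ q : E, TangentSpace 𝓘(ℝ, Model n m) q} {p : E} (hσ : FieldMDiffAt σ p)
    (X : TangentSpace 𝓘(ℝ, Model n m) p) :
    verticalProj Γ ⟨p, σ p⟩ (mfderiv 𝓘(ℝ, Model n m) 𝓘(ℝ, Model n m).tangent
      (fun q => (⟨q, σ q⟩ : TangentBundle 𝓘(ℝ, Model n m) E)) p X) = Γ σ p X := by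
  have : IsManifold 𝓘(ℝ, Model n m) 1 E := .of_le (n := ∞) (by simp)
  have hsource : (⟨p, σ p⟩ : TangentBundle 𝓘(ℝ, Model n m) E) ∈ (tangentTriv n m p).source :=
    (tangentTriv n m p).mem_source.2 (FiberBundle.mem_baseSet_trivializationAt' p)
  have hsnd : MDifferentiableAt 𝓘(ℝ, Model n m).tangent 𝓘(ℝ, Model n m)
      (fun w : TangentBundle 𝓘(ℝ, Model n m) E => (tangentTriv n m p w).2) ⟨p, σ p⟩ :=
    ((Trivialization.mdifferentiableAt_totalSpace_iff (IM := 𝓘(ℝ, Model n m).tangent)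
      (IB := 𝓘(ℝ, Model n m)) (tangentTriv n m p) (fun w => w) hsource).1 mdifferentiableAt_id).2
  have hproj : MDifferentiableAt 𝓘(ℝ, Model n m).tangent 𝓘(ℝ, Model n m)
      (fun w : TangentBundle 𝓘(ℝ, Model n m) E => w.proj) ⟨p, σ p⟩ :=
    mdifferentiableAt_proj _
  have hvert := congrArg (fun T => T X) (mfderiv_comp p hsnd hσ)
  have hhor := congrArg (fun T => T X) (mfderiv_comp p hproj hσ)
  have hid := congrArg (fun T => T X) (mfderiv_id (I := 𝓘(ℝ, Model n m)) (x := p))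
  rw [cov_eq_symm_mvfderiv_add Γ hσ]
  exact congrArg₂ (· + ·) (congrArg ((tangentTriv n m p).symm p) hvert.symm)
    (congrArg (Γ (fun q => (tangentTriv n m p).symm q (tangentTriv n m p ⟨p, σ p⟩).2) p)
      (hhor.symm.trans hid))

variable {B N : Type*} [NormedAddCommGroup B] [NormedSpace ℝ B] [TopologicalSpace N]
  [ChartedSpace B N]

theorem pullbackCov_id (Γ : LinearConnection n m E) {σ : ∀ q : E, TangentSpace 𝓘(ℝ, Model n m) q}
    {p : E} (hσ : FieldMDiffAt σ p) (X : TangentSpace 𝓘(ℝ, Model n m) p) :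
    pullbackCov Γ id σ p X = Γ σ p X :=
  verticalProj_mfderiv Γ hσ X

theorem pullbackCov_congr (Γ : LinearConnection n m E) {f f' : N → E}
    {s : ∀ y, TangentSpace 𝓘(ℝ, Model n m) (f y)} {s' : ∀ y, TangentSpace 𝓘(ℝ, Model n m) (f' y)}
    {y : N} (h : (fun z => (⟨f z, s z⟩ : TangentBundle 𝓘(ℝ, Model n m) E)) =ᶠ[𝓝 y]
      fun z => ⟨f' z, s' z⟩) (v : TangentSpace 𝓘(ℝ, B) y) :
    (show Model n m from pullbackCov Γ f s y v) = pullbackCov Γ f' s' y v := by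
  have hcongr {w w' : TangentBundle 𝓘(ℝ, Model n m) E} (hw : w = w') (ξ : Model n m × Model n m) :
      (show Model n m from verticalProj Γ w ξ) = verticalProj Γ w' ξ := by subst hw; rfl
  have hderiv := congrArg (fun T => T v)
    (h.mfderiv_eq (I := 𝓘(ℝ, B)) (I' := 𝓘(ℝ, Model n m).tangent))
  unfold pullbackCov
  refine (hcongr h.self_of_nhds _).trans ?_
  exact congrArg (verticalProj Γ ⟨f' y, s' y⟩) hderiv

theorem pullbackCov_comp (Γ : LinearConnection n m E) {B' N' : Type*} [NormedAddCommGroup B']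
    [NormedSpace ℝ B'] [TopologicalSpace N'] [ChartedSpace B' N'] {f : N → E}
    {s : ∀ y, TangentSpace 𝓘(ℝ, Model n m) (f y)} {τ : N' → N} {x : N'}
    (hs : MDifferentiableAt 𝓘(ℝ, B) 𝓘(ℝ, Model n m).tangent
      (fun y => (⟨f y, s y⟩ : TangentBundle 𝓘(ℝ, Model n m) E)) (τ x))
    (hτ : MDifferentiableAt 𝓘(ℝ, B') 𝓘(ℝ, B) τ x) (v : TangentSpace 𝓘(ℝ, B') x) :
    pullbackCov Γ (f ∘ τ) (fun z => s (τ z)) x v =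
      pullbackCov Γ f s (τ x) (mfderiv 𝓘(ℝ, B') 𝓘(ℝ, B) τ x v) := by
  have hchain := congrArg (fun T => T v) (mfderiv_comp x hs hτ)
  unfold pullbackCov
  exact congrArg (verticalProj Γ ⟨f (τ x), s (τ x)⟩) hchain

end PullbackConnection

section Christoffel

variable {n m : ℕ} {E : Type*} [TopologicalSpace E] [ChartedSpace (Model n m) E]
  {φ : OpenPartialHomeomorph E (Model n m)}

/-- The Christoffel form of `Γ` at `p` in the divided chart `φ`: `christoffel Γ φ p c a` is the
vector of components of the derivative, in the direction with components `a`, of the vector field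
with constant components `c`. -/
def christoffel [IsManifold 𝓘(ℝ, Model n m) ∞ E] (Γ : LinearConnection n m E)
    (φ : OpenPartialHomeomorph E (Model n m)) (p : E) (c : Model n m) : Model n m →L[ℝ] Model n m :=
  (dChart φ p).comp ((Γ (fun q => chartFrame φ q c) p).comp (chartFrame φ p))

theorem fieldMDiffAt_chartFrame [IsManifold 𝓘(ℝ, Model n m) ∞ E]
    (hφ : φ ∈ IsManifold.maximalAtlas 𝓘(ℝ, Model n m) ∞ E) {p : E} (hp : p ∈ φ.source)
    (c : Model n m) : FieldMDiffAt (fun q => chartFrame φ q c) p :=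
  (contMDiffAt_chartFrame hφ contMDiffAt_id hp contMDiffAt_const).mdifferentiableAt (by simp)

theorem dChart_cov [IsManifold 𝓘(ℝ, Model n m) ∞ E] (Γ : LinearConnection n m E)
    (hφ : φ ∈ IsManifold.maximalAtlas 𝓘(ℝ, Model n m) ∞ E) {p : E} (hp : p ∈ φ.source)
    {Y : ∀ q : E, TangentSpace 𝓘(ℝ, Model n m) q} (hY : FieldMDiffAt Y p)
    (X : TangentSpace 𝓘(ℝ, Model n m) p) :
    dChart φ p (Γ Y p X) = mvfderiv 𝓘(ℝ, Model n m) (fun q => dChart φ q (Y q)) p X +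
      christoffel Γ φ p (dChart φ p (Y p)) (dChart φ p X) := by
  have : IsManifold 𝓘(ℝ, Model n m) 1 E := .of_le (n := ∞) (by simp)
  have hconst : (fun q => dChart φ q (chartFrame φ q (dChart φ p (Y p)))) =ᶠ[𝓝 p]
      fun _ => dChart φ p (Y p) := by
    filter_upwards [φ.open_source.mem_nhds hp] with q hq using dChart_chartFrame hφ hq _
  rw [christoffel, ContinuousLinearMap.comp_apply, ContinuousLinearMap.comp_apply,
    chartFrame_dChart hφ hp]
  exact map_cov_eq_mvfderiv_add Γ (fun q => dChart φ q)
    (fun σ hσ => mdifferentiableAt_dChart hφ hp hσ) hY (fieldMDiffAt_chartFrame hφ hp _)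
    (chartFrame_dChart hφ hp (Y p)).symm hconst X

/-- The constant vector field `c` on a vector space, as a section of the tangent bundle. -/
def constField {B : Type*} [NormedAddCommGroup B] [NormedSpace ℝ B] (c z : B) :
    TangentSpace 𝓘(ℝ, B) z := c

theorem mlieBracket_constField {B : Type*} [NormedAddCommGroup B] [NormedSpace ℝ B] (a c z : B) :
    VectorField.mlieBracket 𝓘(ℝ, B) (constField a) (constField c) z = 0 := by
  rw [← VectorField.mlieBracketWithin_univ, VectorField.mlieBracketWithin_eq_lieBracketWithin]
  change fderivWithin ℝ (fun _ : B => c) univ z a - fderivWithin ℝ (fun _ : B => a) univ z c = 0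
  simp

variable [IsManifold 𝓘(ℝ, Model n m) ∞ E]

theorem mlieBracket_chartFrame (hφ : φ ∈ IsManifold.maximalAtlas 𝓘(ℝ, Model n m) ∞ E) {p : E}
    (hp : p ∈ φ.source) (a c : Model n m) :
    VectorField.mlieBracket 𝓘(ℝ, Model n m) (fun q => chartFrame φ q a)
      (fun q => chartFrame φ q c) p = 0 := by
  have hpullback (c : Model n m) : (fun q => chartFrame φ q c) =ᶠ[𝓝 p]
      VectorField.mpullback 𝓘(ℝ, Model n m) 𝓘(ℝ, Model n m) φ (constField c) := by
    filter_upwards [φ.open_source.mem_nhds hp] with q hq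
    have : (dChart φ q).inverse = chartFrame φ q := ContinuousLinearMap.inverse_eq
      (ContinuousLinearMap.ext fun v => dChart_chartFrame hφ hq v)
      (ContinuousLinearMap.ext fun v => chartFrame_dChart hφ hq v)
    exact congrArg (fun T => T c) this.symm
  have hconst (c : Model n m) : MDifferentiableAt 𝓘(ℝ, Model n m) 𝓘(ℝ, Model n m).tangent
      (fun z => (⟨z, constField c z⟩ : TangentBundle 𝓘(ℝ, Model n m) (Model n m))) (φ p) := by
    rw [mdifferentiableAt_totalSpace]
    exact ⟨mdifferentiableAt_id, by simpa [constField] using mdifferentiableAt_const⟩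
  have : IsManifold 𝓘(ℝ, Model n m) (minSmoothness ℝ 2) E :=
    .of_le (n := ∞) (by simpa using ENat.LEInfty.out)
  have : IsManifold 𝓘(ℝ, Model n m) (minSmoothness ℝ 3) E :=
    .of_le (n := ∞) (by simpa using ENat.LEInfty.out)
  rw [(hpullback a).mlieBracket_vectorField_eq (hpullback c),
    ← VectorField.mpullback_mlieBracket (n := ∞) (hconst a) (hconst c)
      (contMDiffAt_of_mem_maximalAtlas hφ hp) (by simpa using ENat.LEInfty.out),
    VectorField.mpullback_apply]
  exact (congrArg _ (mlieBracket_constField a c (φ p))).trans (map_zero _)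

theorem christoffel_sub_christoffel (Γ : LinearConnection n m E)
    (hφ : φ ∈ IsManifold.maximalAtlas 𝓘(ℝ, Model n m) ∞ E) {p : E} (hp : p ∈ φ.source)
    (a c : Model n m) :
    christoffel Γ φ p c a - christoffel Γ φ p a c =
      dChart φ p (Γ.torsion p (chartFrame φ p a) (chartFrame φ p c)) := by
  have htorsion := Γ.torsion_apply (fieldMDiffAt_chartFrame hφ hp a)
    (fieldMDiffAt_chartFrame hφ hp c)
  rw [mlieBracket_chartFrame hφ hp, sub_zero] at htorsion
  rw [htorsion]
  exact (map_sub (dChart φ p) _ _).symm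

end Christoffel

section TangentPlanes

variable {B M : Type*} [NormedAddCommGroup B] [NormedSpace ℝ B] [TopologicalSpace M]
  [ChartedSpace B M]

theorem mfderiv_eq_of_mem_tangentPlane {B' H' N : Type*} [NormedAddCommGroup B'] [NormedSpace ℝ B']
    [TopologicalSpace H'] {I' : ModelWithCorners ℝ B' H'} [TopologicalSpace N] [ChartedSpace H' N]
    {S : Set M} {p : M} {f g : M → N} (hf : MDifferentiableAt 𝓘(ℝ, B) I' f p)
    (hg : MDifferentiableAt 𝓘(ℝ, B) I' g p) (hfg : ∀ᶠ q in 𝓝 p, q ∈ S → f q = g q)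
    {v : TangentSpace 𝓘(ℝ, B) p} (hv : v ∈ tangentPlane B S p) :
    (show B' from mfderiv 𝓘(ℝ, B) I' f p v) = mfderiv 𝓘(ℝ, B) I' g p v := by
  suffices tangentPlane B S p ≤ LinearMap.eqLocus
      ((mfderiv 𝓘(ℝ, B) I' f p).toLinearMap : B →ₗ[ℝ] B')
      ((mfderiv 𝓘(ℝ, B) I' g p).toLinearMap : B →ₗ[ℝ] B') from this hv
  refine Submodule.span_le.2 ?_
  rintro _ ⟨γ, hγ, rfl, hS, rfl⟩
  have hγ' := (hγ.mdifferentiableAt (by simp)).hasMFDerivAt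
  have hcurve : g ∘ γ =ᶠ[𝓝 (0 : ℝ)] f ∘ γ := by
    filter_upwards [hS, hγ.continuousAt.eventually hfg] with t ht hft using (hft ht).symm
  exact congrArg (fun T => T (1 : ℝ)) (hasMFDerivAt_unique
    ((hf.hasMFDerivAt.comp (0 : ℝ) hγ').congr_of_eventuallyEq hcurve)
    (hg.hasMFDerivAt.comp (0 : ℝ) hγ'))

theorem mfderiv_mem_tangentPlane {B' N : Type*} [NormedAddCommGroup B'] [NormedSpace ℝ B']
    [TopologicalSpace N] [ChartedSpace B' N] {L : Set M} {p : M} {S : Set N} {y : N} {τ : M → N}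
    (hτ : ContMDiffAt 𝓘(ℝ, B) 𝓘(ℝ, B') ∞ τ p) (hy : τ p = y) (hLS : ∀ᶠ q in 𝓝 p, q ∈ L → τ q ∈ S)
    {w : TangentSpace 𝓘(ℝ, B) p} (hw : w ∈ tangentPlane B L p) :
    (show TangentSpace 𝓘(ℝ, B') y from (show B' from mfderiv 𝓘(ℝ, B) 𝓘(ℝ, B') τ p w)) ∈
      tangentPlane B' S y := by
  subst hy
  suffices tangentPlane B L p ≤
      (tangentPlane B' S (τ p)).comap (mfderiv 𝓘(ℝ, B) 𝓘(ℝ, B') τ p).toLinearMap from this hw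
  refine Submodule.span_le.2 ?_
  rintro _ ⟨γ, hγ, rfl, hL, rfl⟩
  refine Submodule.subset_span ⟨τ ∘ γ, hτ.comp (0 : ℝ) hγ, rfl, ?_, ?_⟩
  · filter_upwards [hL, hγ.continuousAt.eventually hLS] with t ht hτt using hτt ht
  · have hchain := mfderiv_comp (0 : ℝ) (hτ.mdifferentiableAt (by simp))
      (hγ.mdifferentiableAt (by simp))
    exact congrArg (fun T => T (1 : ℝ)) hchain

end TangentPlanes

section Graphs

variable {n m : ℕ} {E : Type*} [TopologicalSpace E] [ChartedSpace (Model n m) E]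
  {φ : OpenPartialHomeomorph E (Model n m)}
  {f : EuclideanSpace ℝ (Fin n) → EuclideanSpace ℝ (Fin m)}

theorem IsLocalGraph.eventually {L : Set E} {p : E} (h : IsLocalGraph L p φ f) :
    ∀ᶠ q in 𝓝 p, IsLocalGraph L q φ f := by
  have hφ : Tendsto (fun q => (φ q).1) (𝓝 p) (𝓝 (φ p).1) :=
    (continuous_fst.tendsto _).comp (φ.continuousAt h.mem_source)
  filter_upwards [φ.open_source.mem_nhds h.mem_source,
    hφ.eventually h.contDiffAt.eventually_nhds, h.mem_iff.eventually_nhds]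
    with q hsource hsmooth hmem
  exact ⟨h.mem_maximalAtlas, hsource, hsmooth, hmem⟩

/-- The same submanifold with another base point. -/
def PointedSubmanifold.rebase (P : PointedSubmanifold n m E) {q : E} (hq : q ∈ P.carrier) :
    PointedSubmanifold n m E := { P with pt := q, pt_mem := hq }

theorem HasSlope.mem_plane_iff {θ : GrassmannBundle n m E}
    {A : EuclideanSpace ℝ (Fin n) →L[ℝ] EuclideanSpace ℝ (Fin m)}
    (hφ : φ ∈ IsManifold.maximalAtlas 𝓘(ℝ, Model n m) ∞ E) (hθ : θ.pt ∈ φ.source)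
    (h : HasSlope φ θ A) (v : TangentSpace 𝓘(ℝ, Model n m) θ.pt) :
    v ∈ θ.plane ↔ (dChart φ θ.pt v).2 = A (dChart φ θ.pt v).1 := by
  have hmap : dChart φ θ.pt v ∈ θ.plane.map (dChart φ θ.pt).toLinearMap ↔ v ∈ θ.plane :=
    Function.Injective.mem_set_image (dChart_injective hφ hθ)
  rw [← hmap, h]
  exact LinearMap.mem_graph_iff _ _

variable {P : PointedSubmanifold n m E}

theorem hasSlope_jet1 (h : IsLocalGraph P.carrier P.pt φ f) :
    HasSlope φ P.jet1 (fderiv ℝ f (φ P.pt).1) :=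
  map_tangentPlane P.pt_mem h

theorem IsLocalGraph.mem_tangentPlane_iff (h : IsLocalGraph P.carrier P.pt φ f)
    (v : TangentSpace 𝓘(ℝ, Model n m) P.pt) : v ∈ tangentPlane (Model n m) P.carrier P.pt ↔
      (dChart φ P.pt v).2 = fderiv ℝ f (φ P.pt).1 (dChart φ P.pt v).1 :=
  (hasSlope_jet1 h).mem_plane_iff h.mem_maximalAtlas h.mem_source v

theorem IsLocalGraph.graphEmb_fst_dChart (h : IsLocalGraph P.carrier P.pt φ f)
    {v : TangentSpace 𝓘(ℝ, Model n m) P.pt} (hv : v ∈ tangentPlane (Model n m) P.carrier P.pt) :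
    graphEmb (fderiv ℝ f (φ P.pt).1) (dChart φ P.pt v).1 = dChart φ P.pt v := by
  rw [graphEmb_apply, ← (h.mem_tangentPlane_iff v).1 hv]

theorem HasSlope.chartFrame_graphEmb_mem {θ : GrassmannBundle n m E}
    {A : EuclideanSpace ℝ (Fin n) →L[ℝ] EuclideanSpace ℝ (Fin m)}
    (hφ : φ ∈ IsManifold.maximalAtlas 𝓘(ℝ, Model n m) ∞ E) (hθ : θ.pt ∈ φ.source)
    (h : HasSlope φ θ A) (a : EuclideanSpace ℝ (Fin n)) :
    chartFrame φ θ.pt (graphEmb A a) ∈ θ.plane := by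
  rw [h.mem_plane_iff hφ hθ, dChart_chartFrame hφ hθ, graphEmb_apply]

/-- The graph of a smooth map in a divided chart, as a submanifold. -/
def graphSubmanifold (φ : OpenPartialHomeomorph E (Model n m))
    (hφ : φ ∈ IsManifold.maximalAtlas 𝓘(ℝ, Model n m) ∞ E)
    (f : EuclideanSpace ℝ (Fin n) → EuclideanSpace ℝ (Fin m)) (hf : ContDiff ℝ ∞ f) (p : E)
    (hp : p ∈ φ.source) (hpf : (φ p).2 = f (φ p).1) : PointedSubmanifold n m E where
  carrier := {q | q ∈ φ.source ∧ (φ q).2 = f (φ q).1}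
  exists_graph q hq := ⟨φ, f, hφ, hq.1, .of_forall fun _ => hf.contDiffAt, by
    filter_upwards [φ.open_source.mem_nhds hq.1] with z hz using and_iff_right hz⟩
  pt := p
  pt_mem := ⟨hp, hpf⟩

theorem isLocalGraph_graphSubmanifold (hφ : φ ∈ IsManifold.maximalAtlas 𝓘(ℝ, Model n m) ∞ E)
    (hf : ContDiff ℝ ∞ f) {p : E} (hp : p ∈ φ.source) (hpf : (φ p).2 = f (φ p).1) :
    IsLocalGraph (graphSubmanifold φ hφ f hf p hp hpf).carrier p φ f :=
  ⟨hφ, hp, .of_forall fun _ => hf.contDiffAt, by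
    filter_upwards [φ.open_source.mem_nhds hp] with z hz using and_iff_right hz⟩

end Graphs

section SecondFundamentalForm

variable {n m : ℕ} {E : Type*} [TopologicalSpace E] [ChartedSpace (Model n m) E]
  [IsManifold 𝓘(ℝ, Model n m) ∞ E] {φ : OpenPartialHomeomorph E (Model n m)}
  {f : EuclideanSpace ℝ (Fin n) → EuclideanSpace ℝ (Fin m)} {P : PointedSubmanifold n m E}
  {Y Y' : ∀ q : E, TangentSpace 𝓘(ℝ, Model n m) q}

theorem snd_mvfderiv_dChart (h : IsLocalGraph P.carrier P.pt φ f) (hY : P.IsTangentField Y)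
    {X : TangentSpace 𝓘(ℝ, Model n m) P.pt} (hX : X ∈ tangentPlane (Model n m) P.carrier P.pt) :
    (mvfderiv 𝓘(ℝ, Model n m) (fun q => dChart φ q (Y q)) P.pt X).2 =
      fderiv ℝ (fderiv ℝ f) (φ P.pt).1 (dChart φ P.pt X).1 (dChart φ P.pt (Y P.pt)).1 +
      fderiv ℝ f (φ P.pt).1 (mvfderiv 𝓘(ℝ, Model n m) (fun q => dChart φ q (Y q)) P.pt X).1 := by
  set y : E → Model n m := fun q => dChart φ q (Y q)
  let slopeAt : Model n m × Model n m → EuclideanSpace ℝ (Fin m) := fun c => fderiv ℝ f c.1.1 c.2.1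
  have hy : HasMFDerivAt 𝓘(ℝ, Model n m) 𝓘(ℝ, Model n m) y P.pt (mvfderiv 𝓘(ℝ, Model n m) y P.pt) :=
    (mdifferentiableAt_dChart h.mem_maximalAtlas h.mem_source
      (hY.contMDiffAt.mdifferentiableAt (by simp))).hasMFDerivAt
  have hφ := (mdiff_of_mem h.mem_maximalAtlas h.mem_source).hasMFDerivAt
  have hφy : HasMFDerivAt 𝓘(ℝ, Model n m) 𝓘(ℝ, Model n m × Model n m) (fun q => (φ q, y q)) P.pt
      ((dChart φ P.pt).prod (mvfderiv 𝓘(ℝ, Model n m) y P.pt)) :=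
    ⟨hφ.1.prodMk hy.1, hφ.2.prodMk hy.2⟩
  have hsnd : HasMFDerivAt 𝓘(ℝ, Model n m) 𝓘(ℝ, EuclideanSpace ℝ (Fin m)) (fun q => (y q).2) P.pt
      ((ContinuousLinearMap.snd ℝ _ _).comp (mvfderiv 𝓘(ℝ, Model n m) y P.pt)) :=
    hasFDerivAt_snd.hasMFDerivAt.comp P.pt hy
  have hD : HasFDerivAt (fderiv ℝ f) (fderiv ℝ (fderiv ℝ f) (φ P.pt).1) (φ P.pt).1 :=
    ((h.contDiffAt.self_of_nhds.fderiv_right (m := ∞) (by simp)).differentiableAt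
      (by simp)).hasFDerivAt
  have hDfst : HasFDerivAt (fun c : Model n m × Model n m => fderiv ℝ f c.1.1) _
      (φ P.pt, y P.pt) := HasFDerivAt.comp (φ P.pt, y P.pt) hD hasFDerivAt_fst.fst
  have hslope : HasMFDerivAt 𝓘(ℝ, Model n m) 𝓘(ℝ, EuclideanSpace ℝ (Fin m))
      (fun q => slopeAt (φ q, y q)) P.pt _ :=
    (hDfst.clm_apply hasFDerivAt_snd.fst).hasMFDerivAt.comp P.pt hφy
  have htangent : ∀ᶠ q in 𝓝 P.pt, q ∈ P.carrier → (y q).2 = slopeAt (φ q, y q) := by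
    filter_upwards [h.eventually, hY.tangent] with q hq hYq hqL
    exact (IsLocalGraph.mem_tangentPlane_iff (P := P.rebase hqL) hq _).1 (hYq hqL)
  have hderiv := mfderiv_eq_of_mem_tangentPlane hsnd.mdifferentiableAt hslope.mdifferentiableAt
    htangent hX
  rw [hsnd.mfderiv, hslope.mfderiv] at hderiv
  exact hderiv.trans (add_comm _ _)

/-- The Christoffel form `christoffel Γ φ p` of `Γ` on the plane of slope `A`, modulo this plane:
the fields of the coordinate frame are those with components `(b, A b)`, and the quotient of the
model space by the graph of `A` is identified with the second factor by `(a, c) ↦ c - A a`. -/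
def slopeForm (Γ : LinearConnection n m E) (φ : OpenPartialHomeomorph E (Model n m)) (p : E)
    (A : EuclideanSpace ℝ (Fin n) →L[ℝ] EuclideanSpace ℝ (Fin m)) (b : EuclideanSpace ℝ (Fin n)) :
    EuclideanSpace ℝ (Fin n) →L[ℝ] EuclideanSpace ℝ (Fin m) :=
  (ContinuousLinearMap.snd ℝ _ _ - A.comp (ContinuousLinearMap.fst ℝ _ _)).comp
    ((christoffel Γ φ p (graphEmb A b)).comp (graphEmb A))

theorem snd_dChart_cov_sub (Γ : LinearConnection n m E) (h : IsLocalGraph P.carrier P.pt φ f)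
    (hY : P.IsTangentField Y) {X : TangentSpace 𝓘(ℝ, Model n m) P.pt}
    (hX : X ∈ tangentPlane (Model n m) P.carrier P.pt) :
    (dChart φ P.pt (Γ Y P.pt X)).2 - fderiv ℝ f (φ P.pt).1 (dChart φ P.pt (Γ Y P.pt X)).1 =
      fderiv ℝ (fderiv ℝ f) (φ P.pt).1 (dChart φ P.pt X).1 (dChart φ P.pt (Y P.pt)).1 +
      slopeForm Γ φ P.pt (fderiv ℝ f (φ P.pt).1) (dChart φ P.pt (Y P.pt)).1
        (dChart φ P.pt X).1 := by
  have hYp := h.graphEmb_fst_dChart (hY.tangent.self_of_nhds P.pt_mem)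
  simp only [slopeForm, ContinuousLinearMap.comp_apply, sub_apply, ContinuousLinearMap.coe_fst',
    ContinuousLinearMap.coe_snd']
  rw [h.graphEmb_fst_dChart hX, hYp, dChart_cov Γ h.mem_maximalAtlas h.mem_source
    (hY.contMDiffAt.mdifferentiableAt (by simp)), Prod.snd_add, Prod.fst_add,
    snd_mvfderiv_dChart h hY hX, map_add]
  abel

theorem secondFundamentalForm_eq_zero_iff (Γ : LinearConnection n m E)
    (h : IsLocalGraph P.carrier P.pt φ f) (hY : P.IsTangentField Y)
    (X : tangentPlane (Model n m) P.carrier P.pt) : secondFundamentalForm Γ P X Y = 0 ↔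
      fderiv ℝ (fderiv ℝ f) (φ P.pt).1 (dChart φ P.pt X).1 (dChart φ P.pt (Y P.pt)).1 +
      slopeForm Γ φ P.pt (fderiv ℝ f (φ P.pt).1) (dChart φ P.pt (Y P.pt)).1
        (dChart φ P.pt X).1 = 0 := by
  rw [secondFundamentalForm, Submodule.mkQ_apply, Submodule.Quotient.mk_eq_zero,
    h.mem_tangentPlane_iff, ← sub_eq_zero, snd_dChart_cov_sub Γ h hY X.2]

theorem secondFundamentalForm_congr (Γ : LinearConnection n m E) (hY : P.IsTangentField Y)
    (hY' : P.IsTangentField Y') (hYY' : Y P.pt = Y' P.pt)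
    (X : tangentPlane (Model n m) P.carrier P.pt) :
    secondFundamentalForm Γ P X Y = secondFundamentalForm Γ P X Y' := by
  obtain ⟨φ, f, h⟩ := P.exists_graph P.pt P.pt_mem
  rw [secondFundamentalForm, secondFundamentalForm, Submodule.mkQ_apply, Submodule.mkQ_apply,
    Submodule.Quotient.eq, h.mem_tangentPlane_iff, map_sub, Prod.snd_sub, Prod.fst_sub, map_sub,
    sub_eq_sub_iff_sub_eq_sub, snd_dChart_cov_sub Γ h hY X.2, snd_dChart_cov_sub Γ h hY' X.2, hYY']

theorem isTangentField_chartFrame (h : IsLocalGraph P.carrier P.pt φ f)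
    (b : EuclideanSpace ℝ (Fin n)) :
    P.IsTangentField fun q => chartFrame φ q (graphEmb (fderiv ℝ f (φ q).1) b) := by
  have hφ := h.mem_maximalAtlas
  refine ⟨contMDiffAt_chartFrame hφ contMDiffAt_id h.mem_source ?_, ?_⟩
  · have hD : ContDiffAt ℝ ∞ (fun z : Model n m => fderiv ℝ f z.1) (φ P.pt) :=
      (h.contDiffAt.self_of_nhds.fderiv_right (m := ∞) (by simp)).comp (φ P.pt) contDiffAt_fst
    have hcomp : ContDiffAt ℝ ∞ (fun z : Model n m => graphEmb (fderiv ℝ f z.1) b) (φ P.pt) := by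
      simp only [graphEmb_apply]
      exact contDiffAt_const.prodMk (hD.clm_apply contDiffAt_const)
    exact hcomp.contMDiffAt.comp P.pt (contMDiffAt_of_mem_maximalAtlas hφ h.mem_source)
  · filter_upwards [h.eventually] with q hq hqL
    exact (hasSlope_jet1 (P := P.rebase hqL) hq).chartFrame_graphEmb_mem hφ hq.mem_source b

/-- The submanifold is totally geodesic for `Γ` to second order at its base point: its second
fundamental form vanishes there. -/
def IsTotallyGeodesicAt (Γ : LinearConnection n m E) (P : PointedSubmanifold n m E) : Prop :=
  ∀ X Y, P.IsTangentField Y → secondFundamentalForm Γ P X Y = 0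

theorem isTotallyGeodesicAt_iff (Γ : LinearConnection n m E)
    (h : IsLocalGraph P.carrier P.pt φ f) : IsTotallyGeodesicAt Γ P ↔
      ∀ a b, fderiv ℝ (fderiv ℝ f) (φ P.pt).1 a b +
        slopeForm Γ φ P.pt (fderiv ℝ f (φ P.pt).1) b a = 0 := by
  refine ⟨fun hP a b => ?_, fun hP X Y hY =>
    (secondFundamentalForm_eq_zero_iff Γ h hY X).2 (hP _ _)⟩
  have hX : chartFrame φ P.pt (graphEmb (fderiv ℝ f (φ P.pt).1) a) ∈
      tangentPlane (Model n m) P.carrier P.pt :=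
    (hasSlope_jet1 h).chartFrame_graphEmb_mem h.mem_maximalAtlas h.mem_source a
  have hY := isTangentField_chartFrame h b
  simpa only [dChart_chartFrame h.mem_maximalAtlas h.mem_source, graphEmb_apply] using
    (secondFundamentalForm_eq_zero_iff Γ h hY ⟨_, hX⟩).1 (hP ⟨_, hX⟩ _ hY)

end SecondFundamentalForm

section GrassmannBundleCharts

variable {n m : ℕ} {E : Type*} [TopologicalSpace E] [ChartedSpace (Model n m) E]
  [IsManifold 𝓘(ℝ, Model n m) ∞ E] {φ : OpenPartialHomeomorph E (Model n m)}

/-- The chart `grassmannChart φ hφ` of `J^1(E,n)` as an open partial homeomorphism. -/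
def grassmannHomeomorph (φ : OpenPartialHomeomorph E (Model n m))
    (hφ : φ ∈ IsManifold.maximalAtlas 𝓘(ℝ, Model n m) ∞ E) :
    OpenPartialHomeomorph (GrassmannBundle n m E) (GrassmannModel n m) :=
  grassmannCore.openPartialHomeomorph (grassmannChart φ hφ) ⟨φ, hφ, rfl⟩

theorem grassmannHomeomorph_mem_maximalAtlas (φ : OpenPartialHomeomorph E (Model n m))
    (hφ : φ ∈ IsManifold.maximalAtlas 𝓘(ℝ, Model n m) ∞ E) :
    grassmannHomeomorph φ hφ ∈
      IsManifold.maximalAtlas 𝓘(ℝ, GrassmannModel n m) ∞ (GrassmannBundle n m E) :=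
  IsManifold.subset_maximalAtlas
    (mem_iUnion.2 ⟨grassmannChart φ hφ, mem_iUnion.2 ⟨⟨φ, hφ, rfl⟩, rfl⟩⟩)

theorem contMDiffAt_planeOfSlope (hφ : φ ∈ IsManifold.maximalAtlas 𝓘(ℝ, Model n m) ∞ E)
    {z : GrassmannModel n m} (hz : z.1 ∈ φ.target) :
    ContMDiffAt 𝓘(ℝ, GrassmannModel n m) 𝓘(ℝ, GrassmannModel n m) ∞ (planeOfSlope φ hφ) z :=
  contMDiffAt_symm_of_mem_maximalAtlas (grassmannHomeomorph_mem_maximalAtlas φ hφ) hz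

variable {θ : GrassmannBundle n m E}

theorem eventually_exists_hasSlope (hφ : φ ∈ IsManifold.maximalAtlas 𝓘(ℝ, Model n m) ∞ E)
    (hθ : θ.pt ∈ φ.source) (hs : ∃ A, HasSlope φ θ A) :
    ∀ᶠ θ' in 𝓝 θ, θ'.pt ∈ φ.source ∧ ∃ A, HasSlope φ θ' A :=
  (grassmannHomeomorph φ hφ).open_source.mem_nhds ⟨hθ, hs⟩

theorem contMDiffAt_grassmannChart (hφ : φ ∈ IsManifold.maximalAtlas 𝓘(ℝ, Model n m) ∞ E)
    (hθ : θ.pt ∈ φ.source) (hs : ∃ A, HasSlope φ θ A) :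
    ContMDiffAt 𝓘(ℝ, GrassmannModel n m) 𝓘(ℝ, GrassmannModel n m) ∞ (grassmannChart φ hφ) θ :=
  contMDiffAt_of_mem_maximalAtlas (grassmannHomeomorph_mem_maximalAtlas φ hφ) (x := θ) ⟨hθ, hs⟩

theorem contMDiffAt_slope (hφ : φ ∈ IsManifold.maximalAtlas 𝓘(ℝ, Model n m) ∞ E)
    (hθ : θ.pt ∈ φ.source) (hs : ∃ A, HasSlope φ θ A) :
    ContMDiffAt 𝓘(ℝ, GrassmannModel n m)
      𝓘(ℝ, EuclideanSpace ℝ (Fin n) →L[ℝ] EuclideanSpace ℝ (Fin m)) ∞ (slope φ) θ :=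
  contDiff_snd.contMDiff.contMDiffAt.comp θ (contMDiffAt_grassmannChart hφ hθ hs)

theorem contMDiff_pt : ContMDiff 𝓘(ℝ, GrassmannModel n m) 𝓘(ℝ, Model n m) ∞
    (GrassmannBundle.pt (n := n) (m := m) (E := E)) := by
  intro θ
  obtain ⟨φ, hφ, hθ, hs⟩ := exists_dividedChart θ
  have hcoord : ContMDiffAt 𝓘(ℝ, GrassmannModel n m) 𝓘(ℝ, Model n m) ∞
      (fun θ' : GrassmannBundle n m E => φ θ'.pt) θ :=
    contDiff_fst.contMDiff.contMDiffAt.comp θ (contMDiffAt_grassmannChart hφ hθ hs)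
  refine ((contMDiffAt_symm_of_mem_maximalAtlas hφ (φ.map_source hθ)).comp θ
    hcoord).congr_of_eventuallyEq ?_
  filter_upwards [eventually_exists_hasSlope hφ hθ hs] with θ' hθ' using (φ.left_inv hθ'.1).symm

open Classical in
/-- The section of the tautological bundle whose value at a plane of slope `A` in the divided
chart `φ` has components `(b, A b)`; it is zero at the planes which have no slope. -/
def tautField (φ : OpenPartialHomeomorph E (Model n m)) (b : EuclideanSpace ℝ (Fin n))
    (θ : GrassmannBundle n m E) : TangentSpace 𝓘(ℝ, Model n m) θ.pt :=
  if θ.pt ∈ φ.source ∧ ∃ A, HasSlope φ θ A then chartFrame φ θ.pt (graphEmb (slope φ θ) b) else 0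

theorem isTautologicalSectionAt_tautField (hφ : φ ∈ IsManifold.maximalAtlas 𝓘(ℝ, Model n m) ∞ E)
    (hθ : θ.pt ∈ φ.source) (hs : ∃ A, HasSlope φ θ A) (b : EuclideanSpace ℝ (Fin n)) :
    IsTautologicalSectionAt (tautField φ b) θ := by
  refine ⟨fun θ' => ?_, ?_⟩
  · by_cases h : θ'.pt ∈ φ.source ∧ ∃ A, HasSlope φ θ' A
    · rw [tautField, if_pos h]
      exact (hasSlope_slope h.2).chartFrame_graphEmb_mem hφ h.1 b
    · rw [tautField, if_neg h]
      exact zero_mem _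
  · have hemb : ContDiff ℝ ∞ (fun A : EuclideanSpace ℝ (Fin n) →L[ℝ] EuclideanSpace ℝ (Fin m) =>
        graphEmb A b) := by
      simp only [graphEmb_apply]
      fun_prop
    refine (contMDiffAt_chartFrame hφ contMDiff_pt.contMDiffAt hθ
      (hemb.contMDiff.contMDiffAt.comp θ (contMDiffAt_slope hφ hθ hs))).congr_of_eventuallyEq ?_
    filter_upwards [eventually_exists_hasSlope hφ hθ hs] with θ' hθ'
    rw [tautField, if_pos hθ']
    rfl

theorem exists_isTautologicalSectionAt {w : TangentSpace 𝓘(ℝ, Model n m) θ.pt}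
    (hw : w ∈ θ.plane) : ∃ Y, IsTautologicalSectionAt Y θ ∧ Y θ = w := by
  obtain ⟨φ, hφ, hθ, hs⟩ := exists_dividedChart θ
  refine ⟨tautField φ (dChart φ θ.pt w).1, isTautologicalSectionAt_tautField hφ hθ hs _, ?_⟩
  rw [tautField, if_pos ⟨hθ, hs⟩, graphEmb_apply,
    ← ((hasSlope_slope hs).mem_plane_iff hφ hθ w).1 hw]
  exact chartFrame_dChart hφ hθ w

end GrassmannBundleCharts

section Prolongation

variable {n m : ℕ} {E : Type*} [TopologicalSpace E] [ChartedSpace (Model n m) E]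
  {φ : OpenPartialHomeomorph E (Model n m)}
  {f : EuclideanSpace ℝ (Fin n) → EuclideanSpace ℝ (Fin m)} {P : PointedSubmanifold n m E}

/-- An extension to the domain of `φ` of the prolongation `q ↦ T_q L` of the graph `L` of `f`: it
sends `q` to the plane at `q` whose slope is the derivative of `f` at the first component
of `φ q`. -/
def prolongMap (φ : OpenPartialHomeomorph E (Model n m))
    (hφ : φ ∈ IsManifold.maximalAtlas 𝓘(ℝ, Model n m) ∞ E)
    (f : EuclideanSpace ℝ (Fin n) → EuclideanSpace ℝ (Fin m)) (q : E) : GrassmannBundle n m E :=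
  planeOfSlope φ hφ (φ q, fderiv ℝ f (φ q).1)

theorem pt_prolongMap (hφ : φ ∈ IsManifold.maximalAtlas 𝓘(ℝ, Model n m) ∞ E) {q : E}
    (hq : q ∈ φ.source) : (prolongMap φ hφ f q).pt = q := by
  rw [prolongMap, planeOfSlope_of_mem hφ (φ.map_source hq)]
  exact φ.left_inv hq

theorem eventually_pt_prolongMap (h : IsLocalGraph P.carrier P.pt φ f) :
    ∀ᶠ q in 𝓝 P.pt, (prolongMap φ h.mem_maximalAtlas f q).pt = q := by
  filter_upwards [φ.open_source.mem_nhds h.mem_source] with q hq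
  exact pt_prolongMap h.mem_maximalAtlas hq

theorem prolongMap_pt (h : IsLocalGraph P.carrier P.pt φ f) :
    prolongMap φ h.mem_maximalAtlas f P.pt = P.jet1 := by
  have hpt := pt_prolongMap (f := f) h.mem_maximalAtlas h.mem_source
  exact GrassmannBundle.eq_of_hasSlope h.mem_maximalAtlas (hpt.symm ▸ h.mem_source) hpt
    (hasSlope_planeOfSlope _ (φ.map_source h.mem_source)) (hasSlope_jet1 h)

theorem jet1_mem_prolongation (P : PointedSubmanifold n m E) : P.jet1 ∈ P.prolongation :=
  ⟨P.pt_mem, rfl⟩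

theorem eq_jet1_rebase_of_mem_prolongation {θ : GrassmannBundle n m E} (hθ : θ ∈ P.prolongation) :
    θ = (P.rebase hθ.1).jet1 := by
  obtain ⟨p, W, hW⟩ := θ
  obtain rfl : W = tangentPlane (Model n m) P.carrier p := hθ.2
  rfl

variable [IsManifold 𝓘(ℝ, Model n m) ∞ E]

theorem contMDiffAt_prolongMap (h : IsLocalGraph P.carrier P.pt φ f) :
    ContMDiffAt 𝓘(ℝ, Model n m) 𝓘(ℝ, GrassmannModel n m) ∞
      (prolongMap φ h.mem_maximalAtlas f) P.pt := by
  have hφ := h.mem_maximalAtlas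
  have hcoord : ContDiffAt ℝ ∞ (fun z : Model n m => ((z, fderiv ℝ f z.1) : GrassmannModel n m))
      (φ P.pt) := contDiffAt_id.prodMk (ContDiffAt.comp (φ P.pt)
        (h.contDiffAt.self_of_nhds.fderiv_right (m := ∞) (by simp)) contDiffAt_fst)
  exact ContMDiffAt.comp P.pt (contMDiffAt_planeOfSlope hφ (φ.map_source h.mem_source))
    (hcoord.contMDiffAt.comp P.pt (contMDiffAt_of_mem_maximalAtlas hφ h.mem_source))

/-- The image of `w ∈ T_pL` in `T L^{(1)}` under the differential of the prolongation of `L`. -/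
def prolongVector (h : IsLocalGraph P.carrier P.pt φ f) (w : TangentSpace 𝓘(ℝ, Model n m) P.pt) :
    TangentSpace 𝓘(ℝ, GrassmannModel n m) P.jet1 :=
  show GrassmannModel n m from mfderiv 𝓘(ℝ, Model n m) 𝓘(ℝ, GrassmannModel n m)
    (prolongMap φ h.mem_maximalAtlas f) P.pt w

theorem prolongVector_mem_rPlane (h : IsLocalGraph P.carrier P.pt φ f)
    {w : TangentSpace 𝓘(ℝ, Model n m) P.pt} (hw : w ∈ P.jet1.plane) :
    prolongVector h w ∈ P.rPlane := by
  refine mfderiv_mem_tangentPlane (contMDiffAt_prolongMap h) (prolongMap_pt h) ?_ hw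
  filter_upwards [h.eventually] with q hq hqL
  have hjet : prolongMap φ h.mem_maximalAtlas f q = (P.rebase hqL).jet1 :=
    prolongMap_pt (P := P.rebase hqL) hq
  exact hjet ▸ jet1_mem_prolongation (P.rebase hqL)

theorem mfderiv_pt_prolongVector (h : IsLocalGraph P.carrier P.pt φ f)
    (w : TangentSpace 𝓘(ℝ, Model n m) P.pt) :
    mfderiv 𝓘(ℝ, GrassmannModel n m) 𝓘(ℝ, Model n m) GrassmannBundle.pt P.jet1
      (prolongVector h w) = w := by
  have hpt : HasMFDerivAt 𝓘(ℝ, GrassmannModel n m) 𝓘(ℝ, Model n m) GrassmannBundle.pt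
      (prolongMap φ h.mem_maximalAtlas f P.pt) (mfderiv 𝓘(ℝ, GrassmannModel n m) 𝓘(ℝ, Model n m)
        GrassmannBundle.pt P.jet1 : GrassmannModel n m →L[ℝ] Model n m) := by
    rw [prolongMap_pt h]
    exact (contMDiff_pt.contMDiffAt.mdifferentiableAt (by simp)).hasMFDerivAt
  have hcomp := hpt.comp P.pt ((contMDiffAt_prolongMap h).mdifferentiableAt (by simp)).hasMFDerivAt
  have hid : HasMFDerivAt 𝓘(ℝ, Model n m) 𝓘(ℝ, Model n m)
      (GrassmannBundle.pt ∘ prolongMap φ h.mem_maximalAtlas f) P.pt (ContinuousLinearMap.id ℝ _) :=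
    (hasMFDerivAt_id P.pt).congr_of_eventuallyEq (eventually_pt_prolongMap h)
  exact congrArg (fun T => T w) (hasMFDerivAt_unique hcomp hid)

theorem eq_prolongVector_of_mem_rPlane (h : IsLocalGraph P.carrier P.pt φ f)
    {v : TangentSpace 𝓘(ℝ, GrassmannModel n m) P.jet1} (hv : v ∈ P.rPlane) :
    v = prolongVector h (mfderiv 𝓘(ℝ, GrassmannModel n m) 𝓘(ℝ, Model n m)
      GrassmannBundle.pt P.jet1 v) := by
  have hpt : MDifferentiableAt 𝓘(ℝ, GrassmannModel n m) 𝓘(ℝ, Model n m) GrassmannBundle.pt P.jet1 :=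
    contMDiff_pt.contMDiffAt.mdifferentiableAt (by simp)
  have hprolong : MDifferentiableAt 𝓘(ℝ, Model n m) 𝓘(ℝ, GrassmannModel n m)
      (prolongMap φ h.mem_maximalAtlas f) P.jet1.pt :=
    (contMDiffAt_prolongMap h).mdifferentiableAt (by simp)
  have hid : ∀ᶠ θ in 𝓝 P.jet1, θ ∈ P.prolongation →
      prolongMap φ h.mem_maximalAtlas f θ.pt = id θ := by
    filter_upwards [contMDiff_pt.continuous.continuousAt.eventually h.eventually] with θ hφθ hθ
    exact (prolongMap_pt (P := P.rebase hθ.1) hφθ).trans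
      (eq_jet1_rebase_of_mem_prolongation hθ).symm
  have hderiv := mfderiv_eq_of_mem_tangentPlane (hprolong.comp P.jet1 hpt) mdifferentiableAt_id
    hid hv
  rw [mfderiv_comp P.jet1 hprolong hpt, mfderiv_id] at hderiv
  exact hderiv.symm

end Prolongation

section HorizontalLifts

variable {n m : ℕ} {E : Type*} [TopologicalSpace E] [ChartedSpace (Model n m) E]
  {φ : OpenPartialHomeomorph E (Model n m)}
  {f : EuclideanSpace ℝ (Fin n) → EuclideanSpace ℝ (Fin m)} {P : PointedSubmanifold n m E}
  {Y : ∀ θ : GrassmannBundle n m E, TangentSpace 𝓘(ℝ, Model n m) θ.pt}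

/-- The vector field `q ↦ Y (T_q L)`, extended off the graph `L` of `f` by means of `prolongMap`.
It is meaningful only where `prolongMap` sends `q` to a plane at `q`. -/
def restrictField (h : IsLocalGraph P.carrier P.pt φ f)
    (Y : ∀ θ : GrassmannBundle n m E, TangentSpace 𝓘(ℝ, Model n m) θ.pt) (q : E) :
    TangentSpace 𝓘(ℝ, Model n m) q :=
  show Model n m from Y (prolongMap φ h.mem_maximalAtlas f q)

theorem restrictField_pt (h : IsLocalGraph P.carrier P.pt φ f) :
    restrictField h Y P.pt = Y P.jet1 :=
  congrArg (fun θ => show Model n m from Y θ) (prolongMap_pt h)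

theorem eventually_mk_restrictField (h : IsLocalGraph P.carrier P.pt φ f) :
    (fun q => (⟨(prolongMap φ h.mem_maximalAtlas f q).pt, Y (prolongMap φ h.mem_maximalAtlas f q)⟩ :
      TangentBundle 𝓘(ℝ, Model n m) E)) =ᶠ[𝓝 P.pt] fun q => ⟨q, restrictField h Y q⟩ := by
  filter_upwards [eventually_pt_prolongMap h] with q hq using tangentBundle_mk_congr hq rfl

variable [IsManifold 𝓘(ℝ, Model n m) ∞ E]

theorem isTangentField_restrictField (h : IsLocalGraph P.carrier P.pt φ f)
    (hY : IsTautologicalSectionAt Y P.jet1) : P.IsTangentField (restrictField h Y) := by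
  refine ⟨?_, ?_⟩
  · have hsmooth := hY.contMDiffAt
    rw [← prolongMap_pt h] at hsmooth
    exact (hsmooth.comp P.pt (contMDiffAt_prolongMap h)).congr_of_eventuallyEq
      (eventually_mk_restrictField h).symm
  · filter_upwards [h.eventually] with q hq hqL
    have hval : restrictField h Y q = Y (P.rebase hqL).jet1 :=
      restrictField_pt (P := P.rebase hqL) hq
    exact hval ▸ hY.mem_plane (P.rebase hqL).jet1

theorem pullbackCov_mfderiv_eq_cov (Γ : LinearConnection n m E) {B N : Type*}
    [NormedAddCommGroup B] [NormedSpace ℝ B] [TopologicalSpace N] [ChartedSpace B N] {g : N → E}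
    {s : ∀ y, TangentSpace 𝓘(ℝ, Model n m) (g y)} {τ : E → N} {p : E} {y : N} (hy : τ p = y)
    (hs : MDifferentiableAt 𝓘(ℝ, B) 𝓘(ℝ, Model n m).tangent
      (fun y => (⟨g y, s y⟩ : TangentBundle 𝓘(ℝ, Model n m) E)) y)
    (hτ : MDifferentiableAt 𝓘(ℝ, Model n m) 𝓘(ℝ, B) τ p)
    {σ : ∀ q : E, TangentSpace 𝓘(ℝ, Model n m) q}
    (hσ : (fun q => (⟨g (τ q), s (τ q)⟩ : TangentBundle 𝓘(ℝ, Model n m) E)) =ᶠ[𝓝 p]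
      fun q => ⟨q, σ q⟩) (w : TangentSpace 𝓘(ℝ, Model n m) p) :
    (show Model n m from pullbackCov Γ g s y
      (show B from mfderiv 𝓘(ℝ, Model n m) 𝓘(ℝ, B) τ p w)) = Γ σ p w := by
  subst hy
  have hσ' : FieldMDiffAt σ p := (hs.comp p hτ).congr_of_eventuallyEq hσ.symm
  have hcomp := pullbackCov_comp Γ hs hτ w
  have hcongr := pullbackCov_congr Γ (f := g ∘ τ) (f' := id) (s := fun q => s (τ q)) hσ w
  exact (hcomp.symm.trans hcongr).trans (pullbackCov_id Γ hσ' w)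

theorem dotVerticalProj_prolongVector (Γ : LinearConnection n m E)
    (h : IsLocalGraph P.carrier P.pt φ f) (hY : IsTautologicalSectionAt Y P.jet1)
    (w : tangentPlane (Model n m) P.carrier P.pt) :
    dotVerticalProj Γ P.jet1 (prolongVector h w) Y =
      secondFundamentalForm Γ P w (restrictField h Y) :=
  congrArg P.jet1.plane.mkQ (pullbackCov_mfderiv_eq_cov Γ (prolongMap_pt h)
    (hY.contMDiffAt.mdifferentiableAt (by simp))
    ((contMDiffAt_prolongMap h).mdifferentiableAt (by simp)) (eventually_mk_restrictField h) w.1)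

theorem forall_exists_isHorizontalLift_iff (Γ : LinearConnection n m E)
    (P : PointedSubmanifold n m E) :
    (∀ w ∈ P.jet1.plane, ∃ v ∈ P.rPlane, IsHorizontalLift Γ P.jet1 w v) ↔
      IsTotallyGeodesicAt Γ P := by
  obtain ⟨φ, f, h⟩ := P.exists_graph P.pt P.pt_mem
  refine ⟨fun hlift X Y hY => ?_, fun hP w hw => ⟨prolongVector h w, prolongVector_mem_rPlane h hw,
    mfderiv_pt_prolongVector h w, fun Y hY => ?_⟩⟩
  · obtain ⟨v, hv, hvX, hhor⟩ := hlift X.1 X.2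
    obtain rfl : v = prolongVector h X.1 := by
      rw [eq_prolongVector_of_mem_rPlane h hv, hvX]
    obtain ⟨Z, hZ, hZY⟩ := exists_isTautologicalSectionAt (θ := P.jet1)
      (hY.tangent.self_of_nhds P.pt_mem)
    rw [secondFundamentalForm_congr Γ hY (isTangentField_restrictField h hZ)
      (hZY.symm.trans (restrictField_pt h).symm), ← dotVerticalProj_prolongVector Γ h hZ]
    exact hhor Z hZ
  · rw [dotVerticalProj_prolongVector Γ h hY ⟨w, hw⟩]
    exact hP _ _ (isTangentField_restrictField h hY)

end HorizontalLifts

section ImplicitGraphs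

theorem exists_eventually_contDiffAt_eq_iff {𝕜 X Y Z : Type*} [RCLike 𝕜] [NormedAddCommGroup X]
    [NormedSpace 𝕜 X] [CompleteSpace X] [NormedAddCommGroup Y] [NormedSpace 𝕜 Y] [CompleteSpace Y]
    [NormedAddCommGroup Z] [NormedSpace 𝕜 Z] [CompleteSpace Z] {F : X × Y → Z} {u : X × Y}
    {k : ℕ∞ω} (hk : k ≠ 0) (hF : ∀ᶠ z in 𝓝 u, ContDiffAt 𝕜 k F z)
    (hinv : (fderiv 𝕜 F u ∘L .inr 𝕜 X Y).IsInvertible) :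
    ∃ f : X → Y, (∀ᶠ x in 𝓝 u.1, ContDiffAt 𝕜 k f x) ∧ ∀ᶠ z in 𝓝 u, F z = F u ↔ z.2 = f z.1 := by
  have hFu := hF.self_of_nhds
  set f := hFu.implicitFunction hk hinv
  have hgraph : ∀ᶠ z in 𝓝 u, F z = F u ↔ z.2 = f z.1 := by
    simpa only [eq_comm (b := f _)] using hFu.eventually_apply_eq_iff_implicitFunction hk hinv
  have hunique : ∀ᶠ z in 𝓝 u, (fderiv 𝕜 F z ∘L .inr 𝕜 X Y).IsInvertible := by
    have hopen : {T : Y →L[𝕜] Z | T.IsInvertible} ∈ 𝓝 (fderiv 𝕜 F u ∘L .inr 𝕜 X Y) :=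
      ContinuousLinearEquiv.isOpen.mem_nhds hinv
    exact ((hFu.continuousAt_fderiv hk).clm_comp continuousAt_const).eventually hopen
  have hf : Tendsto (fun x => (x, f x)) (𝓝 u.1) (𝓝 u) := by
    have hcont := (hFu.contDiffAt_implicitFunction hk hinv).continuousAt
    have hfu : f u.1 = u.2 := hFu.implicitFunction_apply_self hk hinv
    exact Tendsto.prodMk_nhds tendsto_id (hfu ▸ hcont.tendsto)
  refine ⟨f, ?_, hgraph⟩
  filter_upwards [hf.eventually hF, hf.eventually hunique, hf.eventually hgraph.eventually_nhds]
    with x hFx hinvx hgraphx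
  have hg := hFx.contDiffAt_implicitFunction hk hinvx
  set g := hFx.implicitFunction hk hinvx
  have hgx : Tendsto (fun x' => (x', g x')) (𝓝 x) (𝓝 (x, f x)) := by
    have hgfx : g x = f x := hFx.implicitFunction_apply_self hk hinvx
    exact Tendsto.prodMk_nhds tendsto_id (hgfx ▸ hg.continuousAt.tendsto)
  refine hg.congr_of_eventuallyEq ?_
  filter_upwards [hgx.eventually hgraphx, hFx.eventually_apply_implicitFunction hk hinvx]
    with x' hiff hFx'
  exact (hiff.1 (hFx'.trans (hgraphx.self_of_nhds.2 rfl))).symm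

variable {n m : ℕ} {E : Type*} [TopologicalSpace E] [ChartedSpace (Model n m) E]
  {φ ψ : OpenPartialHomeomorph E (Model n m)}
  {g : EuclideanSpace ℝ (Fin n) → EuclideanSpace ℝ (Fin m)} {P : PointedSubmanifold n m E}

/-- The left-hand side of the equation `u^i - g^i(u^λ) = 0` of the graph of `g` in the divided chart
`ψ`, as a function of the coordinates of the divided chart `φ`. -/
def graphEquation (ψ : OpenPartialHomeomorph E (Model n m))
    (g : EuclideanSpace ℝ (Fin n) → EuclideanSpace ℝ (Fin m))
    (φ : OpenPartialHomeomorph E (Model n m)) (z : Model n m) : EuclideanSpace ℝ (Fin m) :=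
  (ψ (φ.symm z)).2 - g (ψ (φ.symm z)).1

theorem IsLocalGraph.graphEquation_eq_zero_iff (h : IsLocalGraph P.carrier P.pt ψ g)
    (hp : P.pt ∈ φ.source) :
    ∀ᶠ q in 𝓝 P.pt, graphEquation ψ g φ (φ q) = 0 ↔ q ∈ P.carrier := by
  filter_upwards [h.mem_iff, φ.open_source.mem_nhds hp] with q hqL hq
  rw [graphEquation, φ.left_inv hq, sub_eq_zero, hqL]

theorem IsLocalGraph.fderiv_graphEquation_eq_zero_iff (h : IsLocalGraph P.carrier P.pt ψ g)
    (hφ : φ ∈ IsManifold.maximalAtlas 𝓘(ℝ, Model n m) ∞ E) (hp : P.pt ∈ φ.source) (c : Model n m) :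
    fderiv ℝ (graphEquation ψ g φ) (φ P.pt) c = 0 ↔
      chartFrame φ P.pt c ∈ tangentPlane (Model n m) P.carrier P.pt := by
  have hg := (h.contDiffAt.self_of_nhds.differentiableAt (by simp)).hasFDerivAt
  have hequation : HasFDerivAt (fun u : Model n m => u.2 - g u.1)
      (ContinuousLinearMap.snd ℝ _ _ - (fderiv ℝ g (ψ P.pt).1).comp (ContinuousLinearMap.fst ℝ _ _))
      (ψ (φ.symm (φ P.pt))) := by
    rw [φ.left_inv hp]
    exact hasFDerivAt_snd.sub (hg.comp (ψ P.pt) hasFDerivAt_fst)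
  have hchart : HasMFDerivAt 𝓘(ℝ, Model n m) 𝓘(ℝ, Model n m) ψ (φ.symm (φ P.pt))
      (dChart ψ P.pt : Model n m →L[ℝ] Model n m) := by
    rw [φ.left_inv hp]
    exact (mdiff_of_mem h.mem_maximalAtlas h.mem_source).hasMFDerivAt
  have hchange : HasFDerivAt (ψ ∘ φ.symm) ((dChart ψ P.pt : Model n m →L[ℝ] Model n m).comp
      (chartFrame φ P.pt : Model n m →L[ℝ] Model n m)) (φ P.pt) :=
    hasMFDerivAt_iff_hasFDerivAt.1 (hchart.comp (φ P.pt)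
      (mdiff_symm_of_mem hφ (φ.map_source hp)).hasMFDerivAt)
  have hderiv := (hequation.comp (φ P.pt) hchange).fderiv
  change fderiv ℝ (graphEquation ψ g φ) (φ P.pt) = _ at hderiv
  rw [hderiv, h.mem_tangentPlane_iff]
  exact sub_eq_zero

variable [IsManifold 𝓘(ℝ, Model n m) ∞ E]

theorem IsLocalGraph.eventually_contDiffAt_graphEquation (h : IsLocalGraph P.carrier P.pt ψ g)
    (hφ : φ ∈ IsManifold.maximalAtlas 𝓘(ℝ, Model n m) ∞ E) (hp : P.pt ∈ φ.source) :
    ∀ᶠ z in 𝓝 (φ P.pt), ContDiffAt ℝ ∞ (graphEquation ψ g φ) z := by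
  have hmem : φ P.pt ∈ (φ.symm.trans ψ).source := by
    rw [OpenPartialHomeomorph.trans_source]
    exact ⟨φ.map_source hp, by simpa only [mem_preimage, φ.left_inv hp] using h.mem_source⟩
  have hchange : ∀ᶠ z in 𝓝 (φ P.pt), ContDiffAt ℝ ∞ (ψ ∘ φ.symm) z := by
    filter_upwards [(φ.symm.trans ψ).open_source.eventually_mem hmem] with z hz
    exact (contDiffOn_change hφ h.mem_maximalAtlas).contDiffAt
      ((φ.symm.trans ψ).open_source.mem_nhds hz)
  have hfst : Tendsto (fun z => ((ψ ∘ φ.symm) z).1) (𝓝 (φ P.pt)) (𝓝 (ψ P.pt).1) := by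
    have hcont := hchange.self_of_nhds.continuousAt.fst.tendsto
    simpa only [Function.comp_apply, φ.left_inv hp] using hcont
  filter_upwards [hchange, hfst.eventually h.contDiffAt] with z hz hgz
  exact hz.snd.sub (hgz.comp z hz.fst)

theorem exists_isLocalGraph (hφ : φ ∈ IsManifold.maximalAtlas 𝓘(ℝ, Model n m) ∞ E)
    (hp : P.pt ∈ φ.source) (hs : ∃ A, HasSlope φ P.jet1 A) :
    ∃ f, IsLocalGraph P.carrier P.pt φ f := by
  obtain ⟨A, hA⟩ := hs
  obtain ⟨ψ, g, h⟩ := P.exists_graph P.pt P.pt_mem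
  set F := graphEquation ψ g φ
  have hinj : Function.Injective (fderiv ℝ F (φ P.pt) ∘L .inr ℝ _ _) := by
    refine (injective_iff_map_eq_zero _).2 fun b hb => ?_
    have hplane := (h.fderiv_graphEquation_eq_zero_iff hφ hp _).1 hb
    have hslope : (dChart φ P.pt (chartFrame φ P.pt (0, b))).2 =
        A (dChart φ P.pt (chartFrame φ P.pt (0, b))).1 := (hA.mem_plane_iff hφ hp _).1 hplane
    simpa only [dChart_chartFrame hφ hp, map_zero] using hslope
  have hinv : (fderiv ℝ F (φ P.pt) ∘L .inr ℝ _ _).IsInvertible :=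
    ⟨(LinearEquiv.ofInjectiveEndo _ hinj).toContinuousLinearEquiv, rfl⟩
  obtain ⟨f, hf, hgraph⟩ := exists_eventually_contDiffAt_eq_iff (by simp)
    (h.eventually_contDiffAt_graphEquation hφ hp) hinv
  have hmem := h.graphEquation_eq_zero_iff hp
  refine ⟨f, hφ, hp, hf, ?_⟩
  filter_upwards [hmem, (φ.continuousAt hp).eventually hgraph] with q hq hfq
  rw [← hq, ← hfq, hmem.self_of_nhds.2 P.pt_mem]

end ImplicitGraphs

section TotallyGeodesicJets

variable {n m : ℕ} {E : Type*} [TopologicalSpace E] [ChartedSpace (Model n m) E]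
  [IsManifold 𝓘(ℝ, Model n m) ∞ E] {Γ : LinearConnection n m E} {P Q : PointedSubmanifold n m E}

theorem jet_two_eq (hP : IsTotallyGeodesicAt Γ P) (hQ : IsTotallyGeodesicAt Γ Q)
    (h : P.jet1 = Q.jet1) : P.jet 2 = Q.jet 2 := by
  have hpt : P.pt = Q.pt := congrArg GrassmannBundle.pt h
  obtain ⟨φ, hφ, hp, hs⟩ := exists_dividedChart P.jet1
  obtain ⟨f, hf⟩ := exists_isLocalGraph hφ hp hs
  obtain ⟨g, hg⟩ := exists_isLocalGraph (P := Q) hφ (hpt ▸ hp) (h ▸ hs)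
  have hvalue : f (φ P.pt).1 = g (φ P.pt).1 := by
    rw [← hf.mem_iff.self_of_nhds.1 P.pt_mem, hpt, ← hg.mem_iff.self_of_nhds.1 Q.pt_mem]
  have hslope : fderiv ℝ f (φ P.pt).1 = fderiv ℝ g (φ P.pt).1 := by
    rw [← (hasSlope_jet1 hf).slope_eq, h, hpt, (hasSlope_jet1 hg).slope_eq]
  have hhessian : fderiv ℝ (fderiv ℝ f) (φ P.pt).1 = fderiv ℝ (fderiv ℝ g) (φ P.pt).1 := by
    ext1 a
    ext1 b
    have hfab := (isTotallyGeodesicAt_iff Γ hf).1 hP a b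
    have hgab := (isTotallyGeodesicAt_iff Γ hg).1 hQ a b
    rw [← hpt, ← hslope] at hgab
    exact add_right_cancel (hfab.trans hgab.symm)
  refine Quot.sound ⟨hpt, φ, f, g, hf, hg, fun k hk => ?_⟩
  ext1 v
  interval_cases k
  · simpa only [iteratedFDeriv_zero_apply] using hvalue
  · simp only [iteratedFDeriv_one_apply, hslope]
  · simp only [iteratedFDeriv_two_apply, hhessian]

theorem eq_of_mem_totallyGeodesicEquation {j j' : Jet n m E 2}
    (hj : j ∈ totallyGeodesicEquation Γ) (hj' : j' ∈ totallyGeodesicEquation Γ)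
    (h : jetProj j = jetProj j') : j = j' := by
  obtain ⟨P, rfl, hP⟩ := hj
  obtain ⟨Q, rfl, hQ⟩ := hj'
  exact jet_two_eq hP hQ h

end TotallyGeodesicJets

section Existence

theorem exists_contDiff_of_two_jet {X Y : Type*} [NormedAddCommGroup X] [NormedSpace ℝ X]
    [NormedAddCommGroup Y] [NormedSpace ℝ Y] (x : X) (y : Y) (A : X →L[ℝ] Y)
    (B : X →L[ℝ] X →L[ℝ] Y) (hB : ∀ a b, B a b = B b a) :
    ∃ f : X → Y, ContDiff ℝ ∞ f ∧ f x = y ∧ fderiv ℝ f x = A ∧ fderiv ℝ (fderiv ℝ f) x = B := by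
  set f : X → Y := fun z => y + A (z - x) + (1 / 2 : ℝ) • B (z - x) (z - x)
  have hsub (z : X) : HasFDerivAt (fun z : X => z - x) (.id ℝ X) z := hasFDerivAt_sub_const x
  have hf (z : X) : HasFDerivAt f (A + B (z - x)) z := by
    have hlinear := A.hasFDerivAt.comp z (hsub z)
    have hquadratic := ((B.hasFDerivAt.comp z (hsub z)).clm_apply (hsub z)).const_smul (1 / 2 : ℝ)
    refine ((hlinear.const_add y).add hquadratic).congr_fderiv ?_
    ext1 v
    change A v + (1 / 2 : ℝ) • (B (z - x) v + B v (z - x)) = A v + B (z - x) v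
    rw [hB v]
    module
  have hfderiv : fderiv ℝ f = fun z => A + B (z - x) := funext fun z => (hf z).fderiv
  refine ⟨f, by fun_prop, by simp [f], by simp [hfderiv], ?_⟩
  rw [hfderiv]
  exact ((B.hasFDerivAt.comp x (hsub x)).const_add A).fderiv

theorem exists_continuousBilinearMap_eq {𝕜 X Y : Type*} [NontriviallyNormedField 𝕜]
    [CompleteSpace 𝕜] [NormedAddCommGroup X] [NormedSpace 𝕜 X] [FiniteDimensional 𝕜 X]
    [NormedAddCommGroup Y] [NormedSpace 𝕜 Y] (β : X → X →L[𝕜] Y) (hβ : ∀ a b, β a b = β b a) :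
    ∃ B : X →L[𝕜] X →L[𝕜] Y, ∀ a, B a = β a := by
  refine ⟨LinearMap.toContinuousLinearMap { toFun := β, map_add' := ?_, map_smul' := ?_ },
    fun a => rfl⟩
  · intro a a'
    ext b
    rw [add_apply, hβ, map_add, hβ b, hβ b]
  · intro r a
    ext b
    rw [RingHom.id_apply, smul_apply, hβ, map_smul, hβ b]

variable {n m : ℕ} {E : Type*} [TopologicalSpace E] [ChartedSpace (Model n m) E]
  [IsManifold 𝓘(ℝ, Model n m) ∞ E] {θ : GrassmannBundle n m E}

theorem slopeForm_symm (Γ : LinearConnection n m E)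
    (hΓ : ∀ X ∈ θ.plane, ∀ Y ∈ θ.plane, Γ.torsion θ.pt X Y ∈ θ.plane)
    {φ : OpenPartialHomeomorph E (Model n m)}
    (hφ : φ ∈ IsManifold.maximalAtlas 𝓘(ℝ, Model n m) ∞ E) (hθ : θ.pt ∈ φ.source)
    {A : EuclideanSpace ℝ (Fin n) →L[ℝ] EuclideanSpace ℝ (Fin m)} (hA : HasSlope φ θ A)
    (a b : EuclideanSpace ℝ (Fin n)) :
    slopeForm Γ φ θ.pt A a b = slopeForm Γ φ θ.pt A b a := by
  have htorsion := (hA.mem_plane_iff hφ hθ _).1 (hΓ _ (hA.chartFrame_graphEmb_mem hφ hθ b)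
    _ (hA.chartFrame_graphEmb_mem hφ hθ a))
  rw [← christoffel_sub_christoffel Γ hφ hθ] at htorsion
  refine sub_eq_zero.1 (Eq.trans ?_ (sub_eq_zero.2 htorsion))
  simp only [slopeForm, ContinuousLinearMap.comp_apply, sub_apply, map_sub, Prod.snd_sub,
    Prod.fst_sub, ContinuousLinearMap.coe_snd', ContinuousLinearMap.coe_fst']
  abel

theorem exists_isTotallyGeodesicAt (Γ : LinearConnection n m E)
    (hΓ : ∀ X ∈ θ.plane, ∀ Y ∈ θ.plane, Γ.torsion θ.pt X Y ∈ θ.plane) :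
    ∃ P, P.jet1 = θ ∧ IsTotallyGeodesicAt Γ P := by
  obtain ⟨φ, hφ, hθ, A, hA⟩ := exists_dividedChart θ
  have hsymm := slopeForm_symm Γ hΓ hφ hθ hA
  obtain ⟨B, hB⟩ := exists_continuousBilinearMap_eq (slopeForm Γ φ θ.pt A) hsymm
  obtain ⟨f, hf, hvalue, hslope, hhessian⟩ := exists_contDiff_of_two_jet (φ θ.pt).1 (φ θ.pt).2 A
    (-B) fun a b => by simp only [neg_apply, hB, hsymm a b]
  set P := graphSubmanifold φ hφ f hf θ.pt hθ hvalue.symm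
  have hgraph : IsLocalGraph P.carrier P.pt φ f :=
    isLocalGraph_graphSubmanifold hφ hf hθ hvalue.symm
  have hjet : HasSlope φ P.jet1 A := hslope ▸ hasSlope_jet1 hgraph
  refine ⟨P, GrassmannBundle.eq_of_hasSlope (θ := P.jet1) hφ hθ rfl hjet hA,
    (isTotallyGeodesicAt_iff Γ hgraph).2 fun a b => ?_⟩
  change fderiv ℝ (fderiv ℝ f) (φ θ.pt).1 a b + slopeForm Γ φ θ.pt (fderiv ℝ f (φ θ.pt).1) b a = 0
  rw [hhessian, hslope, neg_apply, neg_apply, hB, hsymm, neg_add_cancel]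

end Existence

section GrassmannianStructure

variable {n m : ℕ} {E : Type*} [TopologicalSpace E] [ChartedSpace (Model n m) E]
  [IsManifold 𝓘(ℝ, Model n m) ∞ E] {Γ Γ' : LinearConnection n m E}
  {s s' : GrassmannBundle n m E → Jet n m E 2}

theorem isGrassmannianStructure_iff : IsGrassmannianStructure Γ s ↔
    ∀ θ, jetProj (s θ) = θ ∧ s θ ∈ totallyGeodesicEquation Γ :=
  forall_congr' fun _ => and_congr_right fun _ => exists_congr fun P =>
    and_congr_right fun _ => forall_exists_isHorizontalLift_iff Γ P

theorem existsUnique_isGrassmannianStructure (hΓ : ∀ θ : GrassmannBundle n m E,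
    ∀ X ∈ θ.plane, ∀ Y ∈ θ.plane, Γ.torsion θ.pt X Y ∈ θ.plane) :
    ∃! s, IsGrassmannianStructure Γ s := by
  choose P hjet hP using fun θ => exists_isTotallyGeodesicAt Γ (hΓ θ)
  have hs : IsGrassmannianStructure Γ fun θ => (P θ).jet 2 :=
    isGrassmannianStructure_iff.2 fun θ => ⟨hjet θ, P θ, rfl, hP θ⟩
  refine ⟨_, hs, fun s' hs' => funext fun θ => ?_⟩
  rw [isGrassmannianStructure_iff] at hs hs'
  exact eq_of_mem_totallyGeodesicEquation (hs' θ).2 (hs θ).2 ((hs' θ).1.trans (hs θ).1.symm)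

theorem IsGrassmannianStructure.totallyGeodesicEquation_eq_range
    (hs : IsGrassmannianStructure Γ s) : totallyGeodesicEquation Γ = range s := by
  rw [isGrassmannianStructure_iff] at hs
  refine Subset.antisymm (fun j hj => ⟨jetProj j, ?_⟩) (range_subset_iff.2 fun θ => (hs θ).2)
  exact eq_of_mem_totallyGeodesicEquation (hs _).2 hj (hs _).1

theorem eq_of_range_eq {α β : Type*} {r : β → α} {s s' : α → β} (hs : Function.LeftInverse r s)
    (hs' : Function.LeftInverse r s') (h : range s = range s') : s = s' := by
  funext x
  obtain ⟨y, hy⟩ := h ▸ mem_range_self (f := s) x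
  obtain rfl : y = x := by rw [← hs' y, hy, hs x]
  exact hy.symm

theorem isGrassmannianEquivalent_iff (hs : IsGrassmannianStructure Γ s)
    (hs' : IsGrassmannianStructure Γ' s') : IsGrassmannianEquivalent Γ Γ' ↔ s = s' := by
  rw [IsGrassmannianEquivalent, hs.totallyGeodesicEquation_eq_range,
    hs'.totallyGeodesicEquation_eq_range]
  exact ⟨eq_of_range_eq (fun θ => (hs θ).1) fun θ => (hs' θ).1, congrArg range⟩

end GrassmannianStructure

end
end SubmanifoldJet

theorem mainTheorem3_general (n m : ℕ) (E : Type*) [TopologicalSpace E]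
    [ChartedSpace (SubmanifoldJet.Model n m) E]
    [IsManifold 𝓘(ℝ, SubmanifoldJet.Model n m) ∞ E]
    (Γ Γ' : SubmanifoldJet.LinearConnection n m E)
    (hΓ : ∀ θ : SubmanifoldJet.GrassmannBundle n m E,
      ∀ X ∈ θ.plane, ∀ Y ∈ θ.plane, Γ.torsion θ.pt X Y ∈ θ.plane)
    (hΓ' : ∀ θ : SubmanifoldJet.GrassmannBundle n m E,
      ∀ X ∈ θ.plane, ∀ Y ∈ θ.plane, Γ'.torsion θ.pt X Y ∈ θ.plane) :
    (∃! s, SubmanifoldJet.IsGrassmannianStructure Γ s) ∧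
    (∃! s', SubmanifoldJet.IsGrassmannianStructure Γ' s') ∧
    ∀ s s' : SubmanifoldJet.GrassmannBundle n m E → SubmanifoldJet.Jet n m E 2,
      SubmanifoldJet.IsGrassmannianStructure Γ s →
      SubmanifoldJet.IsGrassmannianStructure Γ' s' →
      (SubmanifoldJet.IsGrassmannianEquivalent Γ Γ' ↔ s = s') :=
  ⟨SubmanifoldJet.existsUnique_isGrassmannianStructure hΓ,
    SubmanifoldJet.existsUnique_isGrassmannianStructure hΓ',
    fun _ _ => SubmanifoldJet.isGrassmannianEquivalent_iff⟩

theorem mainTheorem3 (n m : ℕ) (E : Type*) [TopologicalSpace E] [T2Space E]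
    [SecondCountableTopology E] [ChartedSpace (SubmanifoldJet.Model n m) E]
    [IsManifold 𝓘(ℝ, SubmanifoldJet.Model n m) ∞ E]
    (Γ Γ' : SubmanifoldJet.LinearConnection n m E)
    (hΓsmooth : CovariantDerivative.ContMDiffCovariantDerivative Γ ∞)
    (hΓ'smooth : CovariantDerivative.ContMDiffCovariantDerivative Γ' ∞)
    (hΓ : Γ.torsion = 0) (hΓ' : Γ'.torsion = 0) :
    (∃! s, SubmanifoldJet.IsGrassmannianStructure Γ s) ∧
    (∃! s', SubmanifoldJet.IsGrassmannianStructure Γ' s') ∧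
    ∀ s s' : SubmanifoldJet.GrassmannBundle n m E → SubmanifoldJet.Jet n m E 2,
      SubmanifoldJet.IsGrassmannianStructure Γ s →
      SubmanifoldJet.IsGrassmannianStructure Γ' s' →
      (SubmanifoldJet.IsGrassmannianEquivalent Γ Γ' ↔ s = s') :=
  mainTheorem3_general n m E Γ Γ' (by simp [hΓ]) (by simp [hΓ'])
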